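/- **Setting.** Let $\mathcal M\subset\mathbb R^D$ be a non-empty compact embedded $C^2$ submanifold (without boundary) of some dimension $m\ge 0$. Write $B(x,r)$ and $\overline B(x,r)$ for open and closed balls. For a non-empty compact set $S\subset\mathbb R^D$ let $d_S$ be the distance to $S$ and $\pi_S(z)=\{y\in S:\ \|z-y\|=d_S(z)\}$ the set of projections of $z$ on $S$. For $z\notin S$ let $$\nabla d_S(z)=\frac{z-m(\pi_S(z))}{d_S(z)},$$ where $m(\sigma)$ is the center of the smallest ball enclosing $\sigma$ (and put $\nabla d_S=0$ on $S$). Let $$Z(S)=\{z\notin S:\nabla d_S(z)=0\},\qquad Z_\mu(S)=\{z\notin S:\|\nabla d_S(z)\|\le\mu\}.$$ **Assumptions.** Assume that * (P1) for every $z_0\in Z(\mathcal M)$, the set $\pi_{\mathcal M}(z_0)$ is the set of vertices of a non-degenerate simplex, and $z_0$ lies in the relative interior of $\mathrm{Conv}(\pi_{\mathcal M}(z_0))$; * (P2) $Z(\mathcal M)$ is finite; * (P3) for every $z_0\in Z(\mathcal M)$ and $x_0\in\pi_{\mathcal M}(z_0)$ there are $\delta,\alpha>0$ such that $\|y-z_0\|^2\ge\|x_0-z_0\|^2+\alpha\|y-x_0\|^2$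 for all $y\in\mathcal M\cap B(x_0,\delta)$. **Local projections.** For $z_0\in Z(\mathcal M)$ write $\pi_{\mathcal M}(z_0)=\{x_1,\dots,x_s\}$ (with distinct $x_j$) and $E=\mathrm{span}\{x_j-x_k:\ 1\le j,k\le s\}$. For $\delta',\delta>0$ we say that the local projections $p_j:B(z_0,\delta')\to B(x_j,\delta)\cap\mathcal M$, $1\le j\le s$, are well-defined if every $z\in B(z_0,\delta')$ has exactly one projection $p_j(z)$ on $\mathcal M\cap\overline B(x_j,\delta)$, this point lies in $B(x_j,\delta)$, the map $p_j$ is $C^1$ on $B(z_0,\delta')$, and $\pi_{\mathcal M}(z)\subset\{p_1(z),\dots,p_s(z)\}$ for all $z\in B(z_0,\delta')$. **Claim.** The following three conditions are equivalent. * (P4) There exist $C>0$ and $\mu_0\in(0,1)$ such that for every $\mu\in[0,\mu_0)$ every point of $Z_\mu(\mathcal M)$ is at distance at most $C\mu$ from $Z(\mathcal M)$. * (Big Simplex Property) For every $z_0\in Z(\mathcal M)$ there are $\delta',\delta,L>0$ such that the local projections $p_j:B(z_0,\delta')\to B(x_j,\delta)\cap\mathcal M$ are well-defined and, for every $h\in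 E^\perp$ with $\|h\|<\delta'$, the (possibly degenerate) $s$-simplex $\Delta(h)$ with vertices $z_0+h$ and $p_j(z_0+h)$, $1\le j\le s$, has $s$-dimensional volume $$\mathrm{Vol}_s(\Delta(h))\ge L\|h\|.$$ * (Non-degeneracy) For every $z_0\in Z(\mathcal M)$ there are $\delta',\delta>0$ for which the local projections $p_j$ are well-defined and the quadratic form $$B(h)=\sum_{i,j=1}^s\det\big(A_i(h)^\top A_j(h)\big)$$ is non-degenerate on $E^\perp$, where $A_i(h)$ is the $D\times s$ matrix obtained from $[x_1-z_0,\dots,x_s-z_0]$ by replacing its $i$-th column by $(dp_i)_{z_0}(h)-h$. -/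

import Mathlib

open MeasureTheory

noncomputable section

namespace DistanceFunction

variable {D : ℕ}

/-- `M` is an `m`-dimensional (embedded) submanifold of class `C²` of `ℝᴰ`: around each of its
points it is the image of an open subset of `ℝᵐ` under a `C²` immersion which is a homeomorphism
onto its image. -/
def IsC2Submanifold (m : ℕ) (M : Set (EuclideanSpace ℝ (Fin D))) : Prop :=
  ∀ x ∈ M, ∃ (U : Set (EuclideanSpace ℝ (Fin m))) (V : Set (EuclideanSpace ℝ (Fin D)))
    (φ : EuclideanSpace ℝ (Fin m) → EuclideanSpace ℝ (Fin D)),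
    IsOpen U ∧ IsOpen V ∧ x ∈ V ∧ ContDiffOn ℝ 2 φ U ∧
    (∀ u ∈ U, Function.Injective (fderiv ℝ φ u)) ∧
    Topology.IsEmbedding (U.domRestrict φ) ∧ φ '' U = M ∩ V

/-- The set `π_S(z)` of all projections of `z` on `S`. -/
def projections (S : Set (EuclideanSpace ℝ (Fin D))) (z : EuclideanSpace ℝ (Fin D)) :
    Set (EuclideanSpace ℝ (Fin D)) :=
  {y | y ∈ S ∧ dist z y = Metric.infDist z S}

/-- `c` is the center of a closed ball of smallest radius among those containing `σ`. -/
def IsSmallestEnclosingBallCenter (σ : Set (EuclideanSpace ℝ (Fin D)))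
    (c : EuclideanSpace ℝ (Fin D)) : Prop :=
  ∃ r : ℝ, σ ⊆ Metric.closedBall c r ∧
    ∀ (c' : EuclideanSpace ℝ (Fin D)) (r' : ℝ), σ ⊆ Metric.closedBall c' r' → r ≤ r'

/-- The center `m(σ)` of the smallest enclosing ball of `σ` (it exists and is unique when `σ` is
bounded and non-empty, which is the only case in which it is used). -/
def smallestEnclosingBallCenter (σ : Set (EuclideanSpace ℝ (Fin D))) :
    EuclideanSpace ℝ (Fin D) :=
  Classical.epsilon (IsSmallestEnclosingBallCenter σ)

/-- The generalized gradient `∇d_S(z) = (z - m(π_S(z))) / d_S(z)` of the distance function to `S`,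
for `z ∉ S`. It is extended by `0` on `S`. -/
def distGradient (S : Set (EuclideanSpace ℝ (Fin D))) (z : EuclideanSpace ℝ (Fin D)) :
    EuclideanSpace ℝ (Fin D) :=
  open Classical in
  if z ∈ S then 0
  else (Metric.infDist z S)⁻¹ • (z - smallestEnclosingBallCenter (projections S z))

/-- The set `Z(S)` of critical points of the distance function to `S`. -/
def criticalPoints (S : Set (EuclideanSpace ℝ (Fin D))) : Set (EuclideanSpace ℝ (Fin D)) :=
  {z | z ∉ S ∧ distGradient S z = 0}

/-- The set `Z_μ(S)` of `μ`-critical points of the distance function to `S`. -/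
def muCriticalPoints (S : Set (EuclideanSpace ℝ (Fin D))) (μ : ℝ) :
    Set (EuclideanSpace ℝ (Fin D)) :=
  {z | z ∉ S ∧ ‖distGradient S z‖ ≤ μ}

/-- (P1): the projections of each critical point are the vertices of a non-degenerate simplex, and
the critical point lies in the relative interior of their convex hull. -/
def PropertyP1 (M : Set (EuclideanSpace ℝ (Fin D))) : Prop :=
  ∀ z₀ ∈ criticalPoints M,
    AffineIndependent ℝ (Subtype.val : projections M z₀ → EuclideanSpace ℝ (Fin D)) ∧
    z₀ ∈ intrinsicInterior ℝ (convexHull ℝ (projections M z₀))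

/-- (P2): there are finitely many critical points. -/
def PropertyP2 (M : Set (EuclideanSpace ℝ (Fin D))) : Prop :=
  (criticalPoints M).Finite

/-- (P3): for each critical point `z₀` and each projection `x₀` of it, the sphere centered at `z₀`
through `x₀` is non-osculating `M` at `x₀`. -/
def PropertyP3 (M : Set (EuclideanSpace ℝ (Fin D))) : Prop :=
  ∀ z₀ ∈ criticalPoints M, ∀ x₀ ∈ projections M z₀, ∃ δ > (0 : ℝ), ∃ α > (0 : ℝ),
    ∀ y ∈ M ∩ Metric.ball x₀ δ, ‖x₀ - z₀‖ ^ 2 + α * ‖y - x₀‖ ^ 2 ≤ ‖y - z₀‖ ^ 2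

/-- (P4): for small `μ`, every `μ`-critical point is at distance at most `C * μ` from the set of
critical points. -/
def PropertyP4 (M : Set (EuclideanSpace ℝ (Fin D))) : Prop :=
  ∃ C > (0 : ℝ), ∃ μ₀ ∈ Set.Ioo (0 : ℝ) 1, ∀ μ ∈ Set.Ico (0 : ℝ) μ₀,
    muCriticalPoints M μ ⊆ Metric.cthickening (C * μ) (criticalPoints M)

/-- The local projection `p` near a point `x` of `M`, sending `z` to its projection on
`M ∩ B̄(x, δ)` (meaningful where that projection is unique). -/
def localProjection (M : Set (EuclideanSpace ℝ (Fin D))) (x : EuclideanSpace ℝ (Fin D)) (δ : ℝ)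
    (z : EuclideanSpace ℝ (Fin D)) : EuclideanSpace ℝ (Fin D) :=
  Classical.epsilon fun y => y ∈ projections (M ∩ Metric.closedBall x δ) z

/-- The local projections around `z₀` with radii `δ'`, `δ` are well-defined: for each
`x ∈ π_M(z₀)`, every `z ∈ B(z₀, δ')` has exactly one projection on `M ∩ B̄(x, δ)`, which belongs to
`B(x, δ)`; the map `B(z₀, δ') → B(x, δ) ∩ M` so obtained is of class `C¹`; and the projections on
`M` of each `z ∈ B(z₀, δ')` are among its local projections. -/
structure LocalProjectionsWellDefined (M : Set (EuclideanSpace ℝ (Fin D)))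
    (z₀ : EuclideanSpace ℝ (Fin D)) (δ' δ : ℝ) : Prop where
  existsUnique : ∀ x ∈ projections M z₀, ∀ z ∈ Metric.ball z₀ δ',
    ∃! y, y ∈ projections (M ∩ Metric.closedBall x δ) z
  mem_ball : ∀ x ∈ projections M z₀, ∀ z ∈ Metric.ball z₀ δ',
    localProjection M x δ z ∈ Metric.ball x δ
  contDiffOn : ∀ x ∈ projections M z₀,
    ContDiffOn ℝ 1 (localProjection M x δ) (Metric.ball z₀ δ')
  projections_subset : ∀ z ∈ Metric.ball z₀ δ',
    projections M z ⊆ (fun x => localProjection M x δ z) '' projections M z₀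

/-- The orthogonal `E^⊥` of the space `E` spanned by the differences of projections of `z₀`. -/
def orthDirections (M : Set (EuclideanSpace ℝ (Fin D))) (z₀ : EuclideanSpace ℝ (Fin D)) :
    Submodule ℝ (EuclideanSpace ℝ (Fin D)) :=
  (vectorSpan ℝ (projections M z₀))ᗮ

/-- `x₁, …, x_s` is a list without repetition of the projections of `z₀` on `M`. -/
def EnumeratesProjections (M : Set (EuclideanSpace ℝ (Fin D))) (z₀ : EuclideanSpace ℝ (Fin D))
    {s : ℕ} (x : Fin s → EuclideanSpace ℝ (Fin D)) : Prop :=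
  Function.Injective x ∧ Set.range x = projections M z₀

/-- The (possibly degenerate) `s`-simplex with vertices `z` and the local projections `p_j(z)`. -/
def projectionSimplex (M : Set (EuclideanSpace ℝ (Fin D))) (δ : ℝ) {s : ℕ}
    (x : Fin s → EuclideanSpace ℝ (Fin D)) (z : EuclideanSpace ℝ (Fin D)) :
    Set (EuclideanSpace ℝ (Fin D)) :=
  convexHull ℝ (insert z (Set.range fun j => localProjection M (x j) δ z))

/-- The Big Simplex Property. The `s`-volume is the `s`-dimensional Hausdorff measure, normalized
so as to agree with Lebesgue measure in dimension `s`. -/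
def BigSimplexProperty (M : Set (EuclideanSpace ℝ (Fin D))) : Prop :=
  ∀ z₀ ∈ criticalPoints M,
    ∃ (s : ℕ) (x : Fin s → EuclideanSpace ℝ (Fin D)), EnumeratesProjections M z₀ x ∧
      ∃ δ' > (0 : ℝ), ∃ δ > (0 : ℝ), ∃ L > (0 : ℝ), LocalProjectionsWellDefined M z₀ δ' δ ∧
        ∀ h ∈ orthDirections M z₀, ‖h‖ < δ' →
          L * ‖h‖ ≤ (μHE[s] : Measure (EuclideanSpace ℝ (Fin D))).real
            (projectionSimplex M δ x (z₀ + h))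

/-- The `D × s` matrix obtained from `[x₁ - z₀, …, x_s - z₀]` by replacing its `i`-th column
by `w`. -/
def replacedMatrix {s : ℕ} (x : Fin s → EuclideanSpace ℝ (Fin D)) (z₀ : EuclideanSpace ℝ (Fin D))
    (i : Fin s) (w : EuclideanSpace ℝ (Fin D)) : Matrix (Fin D) (Fin s) ℝ :=
  (Matrix.of fun a k => (x k - z₀) a).updateCol i (fun a => w a)

/-- The matrix `A_i(h)`: the `i`-th column of `[x₁ - z₀, …, x_s - z₀]` is replaced
by `(dp_i)_{z₀}(h) - h`. -/
def matrixA (M : Set (EuclideanSpace ℝ (Fin D))) (δ : ℝ) {s : ℕ}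
    (x : Fin s → EuclideanSpace ℝ (Fin D)) (z₀ : EuclideanSpace ℝ (Fin D)) (i : Fin s)
    (h : EuclideanSpace ℝ (Fin D)) : Matrix (Fin D) (Fin s) ℝ :=
  replacedMatrix x z₀ i (fderiv ℝ (localProjection M (x i) δ) z₀ h - h)

theorem replacedMatrix_transpose_mul {s : ℕ} (x : Fin s → EuclideanSpace ℝ (Fin D))
    (z₀ : EuclideanSpace ℝ (Fin D)) (i : Fin s) (w : EuclideanSpace ℝ (Fin D))
    (N : Matrix (Fin D) (Fin s) ℝ) :
    (replacedMatrix x z₀ i w).transpose * N =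
      ((Matrix.of fun a k => (x k - z₀) a).transpose * N).updateRow i
        (Matrix.vecMul (fun a => w a) N) := by
  ext k l
  by_cases hk : k = i
  · subst hk
    simp [replacedMatrix, Matrix.mul_apply, Matrix.vecMul, dotProduct]
  · simp [replacedMatrix, Matrix.mul_apply, hk]

theorem det_replacedMatrix_add {s : ℕ} (x : Fin s → EuclideanSpace ℝ (Fin D))
    (z₀ : EuclideanSpace ℝ (Fin D)) (i : Fin s) (v w : EuclideanSpace ℝ (Fin D))
    (N : Matrix (Fin D) (Fin s) ℝ) :
    ((replacedMatrix x z₀ i (v + w)).transpose * N).det =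
      ((replacedMatrix x z₀ i v).transpose * N).det +
        ((replacedMatrix x z₀ i w).transpose * N).det := by
  rw [replacedMatrix_transpose_mul, replacedMatrix_transpose_mul, replacedMatrix_transpose_mul,
    ← Matrix.det_updateRow_add, ← Matrix.add_vecMul]
  rfl

theorem det_replacedMatrix_smul {s : ℕ} (x : Fin s → EuclideanSpace ℝ (Fin D))
    (z₀ : EuclideanSpace ℝ (Fin D)) (i : Fin s) (c : ℝ) (w : EuclideanSpace ℝ (Fin D))
    (N : Matrix (Fin D) (Fin s) ℝ) :
    ((replacedMatrix x z₀ i (c • w)).transpose * N).det =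
      c * ((replacedMatrix x z₀ i w).transpose * N).det := by
  rw [replacedMatrix_transpose_mul, replacedMatrix_transpose_mul,
    ← Matrix.det_updateRow_smul, ← Matrix.smul_vecMul]
  rfl

theorem det_replacedMatrix_comm {s : ℕ} (A B : Matrix (Fin D) (Fin s) ℝ) :
    (A.transpose * B).det = (B.transpose * A).det := by
  rw [← Matrix.det_transpose, Matrix.transpose_mul, Matrix.transpose_transpose]

/-- The symmetric bilinear form `(h, k) ↦ ∑_{i,j} det(A_i(h)ᵀ A_j(k))`. -/
def simplexBilinForm (M : Set (EuclideanSpace ℝ (Fin D))) (δ : ℝ) {s : ℕ}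
    (x : Fin s → EuclideanSpace ℝ (Fin D)) (z₀ : EuclideanSpace ℝ (Fin D)) :
    LinearMap.BilinForm ℝ (EuclideanSpace ℝ (Fin D)) :=
  LinearMap.mk₂ ℝ
    (fun h k => ∑ i, ∑ j, ((matrixA M δ x z₀ i h).transpose * matrixA M δ x z₀ j k).det)
    (fun h h' k => by
      simp only [matrixA, map_add, add_sub_add_comm, det_replacedMatrix_add,
        Finset.sum_add_distrib])
    (fun c h k => by
      simp only [matrixA, map_smul, ← smul_sub, det_replacedMatrix_smul, Finset.mul_sum,
        smul_eq_mul])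
    (fun h k k' => by
      simp only [det_replacedMatrix_comm (matrixA M δ x z₀ _ h)]
      simp only [matrixA, map_add, add_sub_add_comm, det_replacedMatrix_add,
        Finset.sum_add_distrib])
    (fun c h k => by
      simp only [det_replacedMatrix_comm (matrixA M δ x z₀ _ h)]
      simp only [matrixA, map_smul, ← smul_sub, det_replacedMatrix_smul, Finset.mul_sum,
        smul_eq_mul])

/-- The quadratic form `B(h) = ∑_{i,j} det(A_i(h)ᵀ A_j(h))` on `E^⊥`. -/
def simplexForm (M : Set (EuclideanSpace ℝ (Fin D))) (δ : ℝ) {s : ℕ}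
    (x : Fin s → EuclideanSpace ℝ (Fin D)) (z₀ : EuclideanSpace ℝ (Fin D)) :
    QuadraticForm ℝ (orthDirections M z₀) :=
  (simplexBilinForm M δ x z₀).toQuadraticMap.comp (orthDirections M z₀).subtype

theorem simplexForm_apply (M : Set (EuclideanSpace ℝ (Fin D))) (δ : ℝ) {s : ℕ}
    (x : Fin s → EuclideanSpace ℝ (Fin D)) (z₀ : EuclideanSpace ℝ (Fin D))
    (h : orthDirections M z₀) :
    simplexForm M δ x z₀ h =
      ∑ i, ∑ j, ((matrixA M δ x z₀ i h).transpose * matrixA M δ x z₀ j h).det :=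
  rfl

/-- At each critical point `z₀` (the local projections being well-defined around it), the quadratic
form `B` is non-degenerate on `E^⊥`. -/
def SimplexFormNondegenerate (M : Set (EuclideanSpace ℝ (Fin D))) : Prop :=
  ∀ z₀ ∈ criticalPoints M,
    ∃ (s : ℕ) (x : Fin s → EuclideanSpace ℝ (Fin D)), EnumeratesProjections M z₀ x ∧
      ∃ δ' > (0 : ℝ), ∃ δ > (0 : ℝ), LocalProjectionsWellDefined M z₀ δ' δ ∧
        (simplexForm M δ x z₀).Nondegenerate

end DistanceFunction

end

noncomputable section

namespace DistanceFunction

open Filter Topology Metric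
open scoped RealInnerProductSpace

variable {D : ℕ}

/-! Let λ be the barycentric coordinates of a critical point z₀ in the simplex of its projections
x_i; all λ_i are positive. Put T(h) = ∑ λ_i (dp_i(h) - h), the derivative at z₀ of z ↦ ∑ λ_i (p_i(z)
- z). Each of the three conditions says that at every z₀ no nonzero h ∈ E^⊥ has T(h) ∈ E
(`IsTransversallyNondegenerate`).

Quadratic form: since ∑ λ_i (x_i - z₀) = 0, a replacement of column i can be moved to a fixed column
i₀ at the cost of a factor λ_i / λ_{i₀}. Hence λ_{i₀}² B(h) is the Gram determinant of the x_k - z₀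
with the i₀-th vector replaced by T(h). It is nonnegative and vanishes exactly when T(h) ∈ E
(`sq_mul_sum_det`, `simplexForm_nondegenerate_iff`).

Volume: vol(Δ(h)) is a constant times the square root of the Gram determinant of the p_j(z₀+h) -
(z₀+h). Replacing one edge by the λ-combination of all of them, which is T(h) + o(h), shows that
vol² is governed at order ‖h‖² by the same determinant (`tendsto_det_gram`, `exists_le_volume_iff`).

From non-degeneracy to P4: the gradient is at least 1/2 near M, so by compactness a bound c‖z - z₀‖
≤ ‖∇d(z)‖ near each critical point suffices. If it failed along z_n → z₀, the weights of the points
of the hulls nearest to z_n would tend to λ > 0. All local projections would then be true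
projections, at equal distances, so the limit direction v of z_n - z₀ would lie in E^⊥, and
first-order expansion would give T(v) ∈ E (`exists_mul_dist_le_norm_distGradient`).

From P4 to non-degeneracy: if h ∈ E^⊥ and T(h) ∈ E, the implicit function theorem gives points z₀ +
h/n + o(1/n) equidistant from their local projections. Correcting λ at order 1/n makes their
gradient o(1/n). As z₀ is isolated among critical points, P4 puts them within o(1/n) of z₀, so h = 0
(`isTransversallyNondegenerate_of_propertyP4`). -/

/-! ### The gradient as distance to the hull of the projections -/

/-- For a non-empty subset `σ` of a sphere centered at `z`, the point of the closed convex hull of `σ`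
nearest to `z` is the only center of a smallest enclosing ball of `σ`. -/
theorem exists_closedConvexHull_isSmallestEnclosingBallCenter_iff
    {σ : Set (EuclideanSpace ℝ (Fin D))} (hne : σ.Nonempty)
    {z : EuclideanSpace ℝ (Fin D)} {R : ℝ} (hR : ∀ y ∈ σ, dist z y = R) :
    ∃ c ∈ closedConvexHull ℝ σ, (∀ c' ∈ closedConvexHull ℝ σ, dist z c ≤ dist z c') ∧
      ∀ c', IsSmallestEnclosingBallCenter σ c' ↔ c' = c := by
  obtain ⟨c, hc, hmin⟩ := exists_norm_eq_iInf_of_complete_convex (hne.mono subset_closedConvexHull)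
    isClosed_closedConvexHull.isComplete (convex_closedConvexHull) z
  have hin := (norm_eq_iInf_iff_real_inner_le_zero (convex_closedConvexHull) hc).1 hmin
  have hexp : ∀ y, dist z y ^ 2 = dist y c ^ 2 + dist z c ^ 2 - 2 * ⟪z - c, y - c⟫ := by
    intro y
    have h1 : z - y = (z - c) - (y - c) := by abel
    rw [dist_eq_norm z y, h1, norm_sub_sq_real, dist_eq_norm, dist_eq_norm]
    ring
  obtain ⟨y₀, hy₀⟩ := hne
  have hsq : ∀ y ∈ σ, dist y c ^ 2 ≤ R ^ 2 - dist z c ^ 2 := by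
    intro y hy
    have h1 := hexp y
    have h2 := hin y (subset_closedConvexHull hy)
    rw [hR y hy] at h1
    linarith
  set ρ := Real.sqrt (R ^ 2 - dist z c ^ 2) with hρ
  have hρ2 : ρ ^ 2 = R ^ 2 - dist z c ^ 2 :=
    Real.sq_sqrt ((sq_nonneg _).trans (hsq y₀ hy₀))
  have hball : σ ⊆ closedBall c ρ := fun y hy => Real.le_sqrt_of_sq_le (hsq y hy)
  -- On the sphere around `z`, lying in a ball around `c'` is a half-space condition. It passes from
  -- `σ` to its closed convex hull, hence to `c`, where it becomes this inequality. Minimality of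
  -- `ρ` and uniqueness of the center both follow.
  have hkey : ∀ c' r', σ ⊆ closedBall c' r' → 0 ≤ r' ∧ ρ ^ 2 + dist c c' ^ 2 ≤ r' ^ 2 := by
    intro c' r' h
    have hr' : 0 ≤ r' := dist_nonneg.trans (h hy₀)
    refine ⟨hr', ?_⟩
    have hid : ∀ y, dist y c' ^ 2 - dist z y ^ 2 = ‖c'‖ ^ 2 - ‖z‖ ^ 2 + 2 * ⟪z - c', y⟫ := by
      intro y
      rw [dist_eq_norm, dist_eq_norm, norm_sub_sq_real, norm_sub_sq_real, inner_sub_left,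
        real_inner_comm y c']
      ring
    have hsub : σ ⊆ {y | ⟪z - c', y⟫ ≤ (r' ^ 2 - R ^ 2 - ‖c'‖ ^ 2 + ‖z‖ ^ 2) / 2} := by
      intro y hy
      have h1 := hid y
      have h2 : dist y c' ^ 2 ≤ r' ^ 2 := pow_le_pow_left₀ dist_nonneg (h hy) 2
      rw [hR y hy] at h1
      simp only [Set.mem_ofPred_eq]
      linarith
    have hconv : Convex ℝ {y | ⟪z - c', y⟫ ≤ (r' ^ 2 - R ^ 2 - ‖c'‖ ^ 2 + ‖z‖ ^ 2) / 2} :=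
      convex_halfSpace_le (innerSL ℝ (z - c')).toLinearMap.isLinear _
    have h3 := closedConvexHull_min hsub hconv (isClosed_le (by fun_prop) continuous_const) hc
    have h4 := hid c
    simp only [Set.mem_ofPred_eq] at h3
    linarith
  refine ⟨c, hc, ?_, ?_⟩
  · intro c' hc'
    rw [dist_eq_norm, dist_eq_norm, hmin]
    exact ciInf_le ⟨0, by rintro _ ⟨w, rfl⟩; exact norm_nonneg _⟩ (⟨c', hc'⟩ : closedConvexHull ℝ σ)
  · intro c'
    constructor
    · rintro ⟨r', h1, h2⟩
      obtain ⟨h3, h4⟩ := hkey c' r' h1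
      have h5 := pow_le_pow_left₀ h3 (h2 c ρ hball) 2
      have h6 : dist c c' ^ 2 ≤ 0 := by linarith
      have h7 : dist c c' = 0 := by nlinarith [sq_nonneg (dist c c')]
      exact (dist_eq_zero.1 h7).symm
    · rintro rfl
      refine ⟨ρ, hball, fun c'' r'' h => ?_⟩
      obtain ⟨h3, h4⟩ := hkey c'' r'' h
      exact le_of_sq_le_sq (by nlinarith [sq_nonneg (dist c' c'')]) h3

theorem projections_subset {S : Set (EuclideanSpace ℝ (Fin D))} (z : EuclideanSpace ℝ (Fin D)) :
    projections S z ⊆ S := fun _ h => h.1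

theorem projections_nonempty {S : Set (EuclideanSpace ℝ (Fin D))} (hS : IsCompact S)
    (hne : S.Nonempty) (z : EuclideanSpace ℝ (Fin D)) : (projections S z).Nonempty := by
  obtain ⟨y, hy, h⟩ := hS.exists_infDist_eq_dist hne z
  exact ⟨y, hy, h.symm⟩

theorem infDist_pos {S : Set (EuclideanSpace ℝ (Fin D))} (hS : IsCompact S)
    (hne : S.Nonempty) {z : EuclideanSpace ℝ (Fin D)} (hz : z ∉ S) : 0 < infDist z S :=
  (hS.isClosed.notMem_iff_infDist_pos hne).1 hz

/-- Outside of `S`, the generalized gradient is `(z - c) / d_S(z)`, where `c` is the point of the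
closed convex hull of `π_S(z)` nearest to `z`. -/
theorem exists_distGradient_eq {S : Set (EuclideanSpace ℝ (Fin D))} (hS : IsCompact S)
    (hne : S.Nonempty) {z : EuclideanSpace ℝ (Fin D)} (hz : z ∉ S) :
    ∃ c ∈ closedConvexHull ℝ (projections S z), (∀ c' ∈ closedConvexHull ℝ (projections S z),
      dist z c ≤ dist z c') ∧ distGradient S z = (infDist z S)⁻¹ • (z - c) := by
  obtain ⟨c, hc, hmin, hiff⟩ := exists_closedConvexHull_isSmallestEnclosingBallCenter_iff
    (projections_nonempty hS hne z) (fun y hy => hy.2)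
  refine ⟨c, hc, hmin, ?_⟩
  have : smallestEnclosingBallCenter (projections S z) = c :=
    (hiff _).1 (Classical.epsilon_spec (p := IsSmallestEnclosingBallCenter (projections S z))
      ⟨c, (hiff c).2 rfl⟩)
  rw [distGradient, if_neg hz, this]

theorem exists_dist_eq_norm_distGradient_mul {S : Set (EuclideanSpace ℝ (Fin D))}
    (hS : IsCompact S) (hne : S.Nonempty) {z : EuclideanSpace ℝ (Fin D)} (hz : z ∉ S) :
    ∃ c ∈ closedConvexHull ℝ (projections S z), dist z c = ‖distGradient S z‖ * infDist z S := by
  obtain ⟨c, hc, -, h⟩ := exists_distGradient_eq hS hne hz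
  refine ⟨c, hc, ?_⟩
  have := infDist_pos hS hne hz
  rw [h, norm_smul, norm_inv, Real.norm_of_nonneg this.le, dist_eq_norm]
  field_simp

theorem norm_distGradient_mul_le {S : Set (EuclideanSpace ℝ (Fin D))}
    (hS : IsCompact S) (hne : S.Nonempty) {z : EuclideanSpace ℝ (Fin D)} (hz : z ∉ S)
    {c : EuclideanSpace ℝ (Fin D)} (hc : c ∈ closedConvexHull ℝ (projections S z)) :
    ‖distGradient S z‖ * infDist z S ≤ dist z c := by
  obtain ⟨c₀, hc₀, hmin, h⟩ := exists_distGradient_eq hS hne hz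
  refine le_trans (le_of_eq ?_) (hmin c hc)
  have := infDist_pos hS hne hz
  rw [h, norm_smul, norm_inv, Real.norm_of_nonneg this.le, dist_eq_norm]
  field_simp

theorem mem_criticalPoints_iff {S : Set (EuclideanSpace ℝ (Fin D))}
    (hS : IsCompact S) (hne : S.Nonempty) {z : EuclideanSpace ℝ (Fin D)} :
    z ∈ criticalPoints S ↔ z ∉ S ∧ z ∈ closedConvexHull ℝ (projections S z) := by
  refine and_congr_right fun hz => ?_
  have hpos := infDist_pos hS hne hz
  constructor
  · intro h
    obtain ⟨c, hc, hd⟩ := exists_dist_eq_norm_distGradient_mul hS hne hz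
    rw [h, norm_zero, zero_mul, dist_eq_zero] at hd
    rwa [← hd] at hc
  · intro h
    have := norm_distGradient_mul_le hS hne hz h
    rw [dist_self] at this
    exact norm_le_zero_iff.1 (nonpos_of_mul_nonpos_left this hpos)

/-- Upper semicontinuity of `z ↦ π_S(z)`: the compact set `S \ U` is strictly farther from `z` than
`S`, and this strict inequality between continuous functions persists nearby. -/
theorem eventually_projections_subset {S : Set (EuclideanSpace ℝ (Fin D))} (hS : IsCompact S)
    {z : EuclideanSpace ℝ (Fin D)} {U : Set (EuclideanSpace ℝ (Fin D))} (hU : IsOpen U)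
    (hzU : projections S z ⊆ U) : ∀ᶠ w in 𝓝 z, projections S w ⊆ U := by
  rcases (S \ U).eq_empty_or_nonempty with h | h
  · exact Eventually.of_forall fun w y hy => by
      by_contra hyU
      exact (h ▸ (⟨hy.1, hyU⟩ : y ∈ S \ U) : y ∈ (∅ : Set _))
  have hcpt : IsCompact (S \ U) := hS.diff hU
  have hlt : infDist z S < infDist z (S \ U) := by
    obtain ⟨y, hy, he⟩ := hcpt.exists_infDist_eq_dist h z
    rw [he]
    refine lt_of_le_of_ne (infDist_le_dist_of_mem hy.1) fun heq => hy.2 (hzU ⟨hy.1, heq.symm⟩)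
  have hev : ∀ᶠ w in 𝓝 z, infDist w S < infDist w (S \ U) :=
    (continuous_infDist_pt S).continuousAt.eventually_lt
      (continuous_infDist_pt _).continuousAt hlt
  filter_upwards [hev] with w hw y hy
  by_contra hyU
  have := infDist_le_dist_of_mem (x := w) (show y ∈ S \ U from ⟨hy.1, hyU⟩)
  rw [hy.2] at this
  linarith

/-- Closed thickenings of the limit hull are closed and convex, so by semicontinuity they eventually
contain the nearby hulls; their intersection is the limit hull itself. -/
theorem mem_closedConvexHull_projections_of_tendsto {S : Set (EuclideanSpace ℝ (Fin D))}
    (hS : IsCompact S) {α : Type*} {l : Filter α} [l.NeBot]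
    {z c : α → EuclideanSpace ℝ (Fin D)} {z₀ c₀ : EuclideanSpace ℝ (Fin D)}
    (hz : Tendsto z l (𝓝 z₀)) (hc : Tendsto c l (𝓝 c₀))
    (hmem : ∀ᶠ n in l, c n ∈ closedConvexHull ℝ (projections S (z n))) :
    c₀ ∈ closedConvexHull ℝ (projections S z₀) := by
  set K := closedConvexHull ℝ (projections S z₀) with hK
  have hcl : IsClosed K := isClosed_closedConvexHull
  rw [← hcl.closure_eq, closure_eq_iInter_cthickening]
  simp only [Set.mem_iInter]
  intro ε hε
  have h1 : ∀ᶠ n in l, projections S (z n) ⊆ thickening ε K :=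
    hz.eventually (eventually_projections_subset hS isOpen_thickening
      (subset_closedConvexHull.trans (self_subset_thickening hε _)))
  refine isClosed_cthickening.mem_of_tendsto hc ?_
  filter_upwards [h1, hmem] with n h2 h3
  exact closedConvexHull_min (h2.trans (thickening_subset_cthickening _ _))
    (convex_closedConvexHull.cthickening ε) isClosed_cthickening h3

theorem mem_criticalPoints_of_tendsto {S : Set (EuclideanSpace ℝ (Fin D))}
    (hS : IsCompact S) (hne : S.Nonempty) {α : Type*} {l : Filter α} [l.NeBot]
    {z : α → EuclideanSpace ℝ (Fin D)} {z₀ : EuclideanSpace ℝ (Fin D)}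
    (hz : Tendsto z l (𝓝 z₀)) (hzS : ∀ n, z n ∉ S) (hz₀ : z₀ ∉ S)
    (hgrad : Tendsto (fun n => ‖distGradient S (z n)‖) l (𝓝 0)) : z₀ ∈ criticalPoints S := by
  refine (mem_criticalPoints_iff hS hne).2 ⟨hz₀, ?_⟩
  choose c hc hd using fun n => exists_dist_eq_norm_distGradient_mul hS hne (hzS n)
  refine mem_closedConvexHull_projections_of_tendsto hS hz ?_ (Eventually.of_forall hc)
  have h1 : Tendsto (fun n => dist (z n) (c n)) l (𝓝 0) := by
    simp only [hd]
    simpa using hgrad.mul ((continuous_infDist_pt S).continuousAt.tendsto.comp hz)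
  exact (tendsto_iff_of_dist h1).1 hz

/-- Such a `z` is within `d_S(z) / 2` of the hull of `S`, while `d_S(z)` is at most the distance to
a point of `S`; hence `z` cannot be far away. This supplies compactness for sequences of almost
critical points. -/
theorem exists_subset_closedBall_of_norm_distGradient_le {S : Set (EuclideanSpace ℝ (Fin D))}
    (hS : IsCompact S) (hne : S.Nonempty) :
    ∃ (x : EuclideanSpace ℝ (Fin D)) (R : ℝ), ∀ z ∉ S, ‖distGradient S z‖ ≤ 1 / 2 →
      z ∈ closedBall x R := by
  obtain ⟨x, hx⟩ := hne
  obtain ⟨R, hR⟩ := hS.isBounded.subset_closedBall x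
  refine ⟨x, 2 * R, fun z hz hle => ?_⟩
  obtain ⟨c, hc, hd⟩ := exists_dist_eq_norm_distGradient_mul hS ⟨x, hx⟩ hz
  have h1 : c ∈ closedBall x R := closedConvexHull_min ((projections_subset z).trans hR)
    (convex_closedBall x R) isClosed_closedBall hc
  have h2 : infDist z S ≤ dist z x := infDist_le_dist_of_mem hx
  have h3 := dist_triangle z c x
  have h4 : 0 ≤ infDist z S := infDist_nonneg
  rw [mem_closedBall] at h1 ⊢
  nlinarith

/-! ### First-order condition, charts, and the gradient near the submanifold -/

theorem inner_fderiv_eq_zero_of_dist_le {F : Type*} [NormedAddCommGroup F] [NormedSpace ℝ F]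
    {φ : F → EuclideanSpace ℝ (Fin D)} {u : F} {z : EuclideanSpace ℝ (Fin D)}
    (hφ : DifferentiableAt ℝ φ u) (hmin : ∀ᶠ w in 𝓝 u, dist z (φ u) ≤ dist z (φ w)) (v : F) :
    ⟪φ u - z, fderiv ℝ φ u v⟫ = 0 := by
  have h1 : IsLocalMin (fun w => ‖φ w - z‖ ^ 2) u := by
    filter_upwards [hmin] with w hw
    rw [dist_comm, dist_eq_norm, dist_comm, dist_eq_norm] at hw
    exact pow_le_pow_left₀ (norm_nonneg _) hw 2
  have h2 := h1.hasFDerivAt_eq_zero ((hφ.hasFDerivAt.sub_const z).norm_sq)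
  have h3 := congrArg (fun L => L v) h2
  simpa [inner_sub_left] using h3

/-- A submanifold of class `C²` has a `C²` immersive chart around each of its points. -/
theorem IsC2Submanifold.exists_chart {m : ℕ} {M : Set (EuclideanSpace ℝ (Fin D))}
    (hM : IsC2Submanifold m M) {x : EuclideanSpace ℝ (Fin D)} (hx : x ∈ M) :
    ∃ (φ : EuclideanSpace ℝ (Fin m) → EuclideanSpace ℝ (Fin D)) (u₀ : EuclideanSpace ℝ (Fin m)),
      φ u₀ = x ∧ ContDiffAt ℝ 2 φ u₀ ∧ Function.Injective (fderiv ℝ φ u₀) ∧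
        map φ (𝓝 u₀) = 𝓝[M] x := by
  obtain ⟨U, V, φ, hU, hV, hxV, hφ, hinj, hemb, himg⟩ := hM x hx
  obtain ⟨u₀, hu₀, rfl⟩ : x ∈ φ '' U := by rw [himg]; exact ⟨hx, hxV⟩
  refine ⟨φ, u₀, rfl, hφ.contDiffAt (hU.mem_nhds hu₀), hinj u₀ hu₀, ?_⟩
  have h1 := hemb.isInducing.map_nhds_eq (⟨u₀, hu₀⟩ : U)
  have h2 : map (U.domRestrict φ) (𝓝 (⟨u₀, hu₀⟩ : U)) = map φ (𝓝 u₀) := by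
    rw [← hU.isOpenEmbedding_subtypeVal.map_nhds_eq (⟨u₀, hu₀⟩ : U), Filter.map_map]
    rfl
  rw [← h2, h1]
  have h3 : Set.range (U.domRestrict φ) = M ∩ V := by rw [← himg]; exact Set.range_domRestrict φ U
  rw [h3]
  exact nhdsWithin_inter_of_mem' (mem_nhdsWithin_of_mem_nhds (hV.mem_nhds hxV))

theorem exists_pos_mul_norm_le_of_injective {m : ℕ}
    {A : EuclideanSpace ℝ (Fin m) →L[ℝ] EuclideanSpace ℝ (Fin D)} (hA : Function.Injective A) :
    ∃ κ > 0, ∀ v, κ * ‖v‖ ≤ ‖A v‖ := by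
  obtain ⟨K, hK, h⟩ := A.toLinearMap.exists_antilipschitzWith (LinearMap.ker_eq_bot.2 hA)
  refine ⟨(K : ℝ)⁻¹, by positivity, fun v => ?_⟩
  have := h.le_mul_dist v 0
  simp only [dist_zero_right, map_zero, ContinuousLinearMap.coe_coe] at this
  rwa [inv_mul_le_iff₀ (by positivity)]

/-- Close to a submanifold, but outside of it, the gradient of the distance is not small. -/
theorem IsC2Submanifold.eventually_half_le_norm_distGradient {m : ℕ}
    {M : Set (EuclideanSpace ℝ (Fin D))} (hM : IsC2Submanifold m M) (hcpt : IsCompact M)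
    {x : EuclideanSpace ℝ (Fin D)} (hx : x ∈ M) :
    ∀ᶠ z in 𝓝 x, z ∉ M → 1 / 2 ≤ ‖distGradient M z‖ := by
  have hne : M.Nonempty := ⟨x, hx⟩
  obtain ⟨φ, u₀, rfl, hφ, hinj, hmap⟩ := hM.exists_chart hx
  obtain ⟨κ, hκ, hA⟩ := exists_pos_mul_norm_le_of_injective hinj
  set A := fderiv ℝ φ u₀ with hAdef
  have hstrict : HasStrictFDerivAt φ A u₀ := hφ.hasStrictFDerivAt (by norm_num)
  -- With two errors of size `κ / 9`, the deviation from the tangent is at most `2κ/9 ‖u' - u‖`, a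
  -- quarter of the lower bound `8κ/9 ‖u' - u‖` for the chord.
  have hε : 0 < κ / 9 := by positivity
  have h1 : ∀ᶠ p : EuclideanSpace ℝ (Fin m) × EuclideanSpace ℝ (Fin m) in 𝓝 (u₀, u₀),
      ‖φ p.1 - φ p.2 - A (p.1 - p.2)‖ ≤ κ / 9 * ‖p.1 - p.2‖ := hstrict.isLittleO.bound hε
  rw [nhds_prod_eq, eventually_prod_self_iff'] at h1
  obtain ⟨N, hN, h1⟩ := h1
  have h2 : ∀ᶠ u in 𝓝 u₀, ‖fderiv ℝ φ u - A‖ ≤ κ / 9 := by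
    have : ContinuousAt (fderiv ℝ φ) u₀ := hφ.continuousAt_fderiv (by norm_num)
    have := this.eventually (closedBall_mem_nhds A hε)
    filter_upwards [this] with u hu
    rwa [← dist_eq_norm]
  have h3 : ∀ᶠ u in 𝓝 u₀, DifferentiableAt ℝ φ u := by
    filter_upwards [hφ.eventually (by norm_num)] with u hu
    exact hu.differentiableAt (by norm_num)
  have h4 : ∀ᶠ u in 𝓝 u₀, ∀ᶠ w in 𝓝 u, φ w ∈ M := by
    rw [eventually_eventually_nhds]
    have : ∀ᶠ y in 𝓝[M] (φ u₀), y ∈ M := eventually_mem_nhdsWithin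
    rwa [← hmap, eventually_map] at this
  have h5 : φ '' {u | u ∈ N ∧ ‖fderiv ℝ φ u - A‖ ≤ κ / 9 ∧ DifferentiableAt ℝ φ u ∧
      ∀ᶠ w in 𝓝 u, φ w ∈ M} ∈ 𝓝[M] (φ u₀) := by
    rw [← hmap]
    exact image_mem_map (by filter_upwards [hN, h2, h3, h4] with u a b c d using ⟨a, b, c, d⟩)
  obtain ⟨W, hW, hxW, hsub⟩ := mem_nhdsWithin.1 h5
  have hproj : projections M (φ u₀) ⊆ W := by
    rintro y ⟨-, hy⟩
    rw [infDist_zero_of_mem hx, dist_eq_zero] at hy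
    rwa [← hy]
  filter_upwards [eventually_projections_subset hcpt hW hproj] with z hz hzM
  have hdpos := infDist_pos hcpt hne hzM
  set d := infDist z M with hd
  obtain ⟨y, hy⟩ := projections_nonempty hcpt hne z
  -- Two projections of `z` are both at distance `d`, so the squared chord equals `-2⟪φ u - z, φ u'
  -- - φ u⟫`. Since `φ u - z` is normal at `φ u`, this is at most `2d` times a quarter of the chord.
  -- The hull thus stays within `d / 2` of `y`, hence at least `d / 2` away from `z`.
  have hball : projections M z ⊆ closedBall y (d / 2) := by
    intro y' hy'
    obtain ⟨u, ⟨huN, huA, hudiff, huM⟩, rfl⟩ := hsub ⟨hz hy, hy.1⟩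
    obtain ⟨u', ⟨hu'N, -⟩, rfl⟩ := hsub ⟨hz hy', hy'.1⟩
    have hs := h1 u' hu'N u huN
    simp only at hs
    have hcrit := inner_fderiv_eq_zero_of_dist_le (z := z) hudiff (by
      filter_upwards [huM] with w hw
      rw [hy.2]
      exact infDist_le_dist_of_mem hw) (u' - u)
    have hlow : κ * ‖u' - u‖ ≤ ‖φ u' - φ u‖ + κ / 9 * ‖u' - u‖ := by
      have e : A (u' - u) = (φ u' - φ u) - (φ u' - φ u - A (u' - u)) := by abel
      calc κ * ‖u' - u‖ ≤ ‖A (u' - u)‖ := hA _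
        _ ≤ ‖φ u' - φ u‖ + ‖φ u' - φ u - A (u' - u)‖ := by
          conv_lhs => rw [e]
          exact norm_sub_le _ _
        _ ≤ _ := by gcongr
    have hdev : ‖φ u' - φ u - fderiv ℝ φ u (u' - u)‖ ≤ 2 * (κ / 9) * ‖u' - u‖ := by
      have e : φ u' - φ u - fderiv ℝ φ u (u' - u) =
          (φ u' - φ u - A (u' - u)) - (fderiv ℝ φ u - A) (u' - u) := by
        rw [sub_apply]; abel
      rw [e]
      have := (fderiv ℝ φ u - A).le_of_opNorm_le huA (u' - u)
      linarith [norm_sub_le (φ u' - φ u - A (u' - u)) ((fderiv ℝ φ u - A) (u' - u))]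
    have hdev2 : ‖φ u' - φ u - fderiv ℝ φ u (u' - u)‖ ≤ 1 / 4 * ‖φ u' - φ u‖ := by linarith
    have e1 : ⟪φ u - z, φ u' - φ u⟫ = ⟪φ u - z, φ u' - φ u - fderiv ℝ φ u (u' - u)⟫ := by
      rw [inner_sub_right (φ u - z) (φ u' - φ u), hcrit, sub_zero]
    have e2 : ‖φ u - z‖ = d := by rw [← dist_eq_norm, dist_comm]; exact hy.2
    have e3 : ‖φ u' - z‖ = d := by rw [← dist_eq_norm, dist_comm]; exact hy'.2
    have e4 : ‖φ u' - z‖ ^ 2 = ‖φ u' - φ u‖ ^ 2 + 2 * ⟪φ u - z, φ u' - φ u⟫ + ‖φ u - z‖ ^ 2 := by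
      rw [← sub_add_sub_cancel (φ u') (φ u) z, norm_add_sq_real, real_inner_comm]
    have e5 : -⟪φ u - z, φ u' - φ u⟫ ≤ d * (1 / 4 * ‖φ u' - φ u‖) := by
      rw [e1]
      calc _ ≤ |⟪φ u - z, φ u' - φ u - fderiv ℝ φ u (u' - u)⟫| := neg_le_abs _
        _ ≤ ‖φ u - z‖ * ‖φ u' - φ u - fderiv ℝ φ u (u' - u)‖ := abs_real_inner_le_norm _ _
        _ ≤ _ := by rw [e2]; gcongr
    rw [e2, e3] at e4
    rw [mem_closedBall, dist_eq_norm]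
    rcases (norm_nonneg (φ u' - φ u)).eq_or_lt with h0 | h0
    · rw [← h0]; positivity
    · nlinarith
  obtain ⟨c, hc, hcd⟩ := exists_dist_eq_norm_distGradient_mul hcpt hne hzM
  have hcy : c ∈ closedBall y (d / 2) :=
    closedConvexHull_min hball (convex_closedBall _ _) isClosed_closedBall hc
  have h6 := dist_triangle z c y
  rw [hy.2] at h6
  rw [mem_closedBall] at hcy
  nlinarith

/-! ### Existence and regularity of local projections -/

theorem localProjection_mem_projections {M : Set (EuclideanSpace ℝ (Fin D))}
    {x z : EuclideanSpace ℝ (Fin D)} {δ : ℝ}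
    (h : ∃! y, y ∈ projections (M ∩ closedBall x δ) z) :
    localProjection M x δ z ∈ projections (M ∩ closedBall x δ) z :=
  Classical.epsilon_spec (p := fun y => y ∈ projections (M ∩ closedBall x δ) z) h.exists

theorem eq_localProjection {M : Set (EuclideanSpace ℝ (Fin D))}
    {x y z : EuclideanSpace ℝ (Fin D)} {δ : ℝ}
    (h : ∃! y, y ∈ projections (M ∩ closedBall x δ) z)
    (hy : y ∈ projections (M ∩ closedBall x δ) z) : y = localProjection M x δ z :=
  h.unique hy (localProjection_mem_projections h)

theorem mem_projections_inter {M T : Set (EuclideanSpace ℝ (Fin D))}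
    {y z : EuclideanSpace ℝ (Fin D)} (hy : y ∈ projections M z) (hyT : y ∈ T) :
    y ∈ projections (M ∩ T) z :=
  ⟨⟨hy.1, hyT⟩, le_antisymm
    (hy.2.le.trans (infDist_le_infDist_of_subset Set.inter_subset_left ⟨y, hy.1, hyT⟩))
    (infDist_le_dist_of_mem ⟨hy.1, hyT⟩)⟩

theorem isInvertible_of_injective_dual {m : ℕ}
    {H : EuclideanSpace ℝ (Fin m) →L[ℝ] (EuclideanSpace ℝ (Fin m) →L[ℝ] ℝ)}
    (hH : Function.Injective H) : H.IsInvertible := by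
  have hfin : Module.finrank ℝ (EuclideanSpace ℝ (Fin m)) =
      Module.finrank ℝ (EuclideanSpace ℝ (Fin m) →L[ℝ] ℝ) := by
    rw [← (LinearMap.toContinuousLinearMap (𝕜 := ℝ) (E := EuclideanSpace ℝ (Fin m))
      (F' := ℝ)).finrank_eq]
    exact Subspace.dual_finrank_eq.symm
  refine ⟨(LinearMap.linearEquivOfInjective H.toLinearMap hH hfin).toContinuousLinearEquiv, ?_⟩
  ext v
  rfl

/-- A `C²` immersion is met non-degenerately by a sphere which it touches from the outside to
order exactly two. -/
theorem injective_fderiv_inner_of_quadratic_growth {m : ℕ}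
    {φ : EuclideanSpace ℝ (Fin m) → EuclideanSpace ℝ (Fin D)} {u₀ : EuclideanSpace ℝ (Fin m)}
    {z₀ : EuclideanSpace ℝ (Fin D)} (hφ : ContDiffAt ℝ 2 φ u₀)
    (hinj : Function.Injective (fderiv ℝ φ u₀)) {α : ℝ} (hα : 0 < α)
    (h : ∀ᶠ u in 𝓝 u₀, ‖φ u₀ - z₀‖ ^ 2 + α * ‖φ u - φ u₀‖ ^ 2 ≤ ‖φ u - z₀‖ ^ 2)
    {L : EuclideanSpace ℝ (Fin m) →L[ℝ] (EuclideanSpace ℝ (Fin m) →L[ℝ] ℝ)}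
    (hL : HasFDerivAt (fun u => (innerSL ℝ (φ u - z₀)).comp (fderiv ℝ φ u)) L u₀)
    (h0 : (innerSL ℝ (φ u₀ - z₀)).comp (fderiv ℝ φ u₀) = 0) :
    Function.Injective L := by
  rw [injective_iff_map_eq_zero]
  intro v hv
  by_contra hv0
  obtain ⟨κ, hκ, hA⟩ := exists_pos_mul_norm_le_of_injective hinj
  have hvpos : 0 < ‖v‖ := norm_pos_iff.2 hv0
  -- Half of `κ` is spent on the first-order remainder of `φ`, so the squared distance grows by at
  -- least `β t²` along the line through `u₀` directed by `v`.
  set β := α * (κ / 2 * ‖v‖) ^ 2 with hβ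
  have hβpos : 0 < β := by positivity
  have hline : Tendsto (fun t : ℝ => u₀ + t • v) (𝓝 0) (𝓝 u₀) := by
    have : Continuous fun t : ℝ => u₀ + t • v := by fun_prop
    simpa using this.tendsto 0
  have hlineD : ∀ t : ℝ, HasDerivAt (fun t : ℝ => u₀ + t • v) v t := fun t => by
    simpa using ((hasDerivAt_id t).smul_const v).const_add u₀
  -- the second-order expansion along the line has no quadratic term
  have hsmall : ∀ᶠ t : ℝ in 𝓝 0,
      |⟪φ (u₀ + t • v) - z₀, fderiv ℝ φ (u₀ + t • v) v⟫| ≤ β / 4 * |t| := by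
    have h1 : HasFDerivAt (fun u => (innerSL ℝ (φ u - z₀)).comp (fderiv ℝ φ u)) L
        (u₀ + (0 : ℝ) • v) := by simpa using hL
    have h2 := h1.comp_hasDerivAt (0 : ℝ) (hlineD 0)
    rw [hv] at h2
    have h3 := h2.isLittleO.bound (c := β / 4 / ‖v‖) (by positivity)
    filter_upwards [h3] with t ht
    simp only [Function.comp_apply, zero_smul, add_zero, h0, sub_zero, smul_zero] at ht
    have h4 := ((innerSL ℝ (φ (u₀ + t • v) - z₀)).comp (fderiv ℝ φ (u₀ + t • v))).le_opNorm v
    simp only [ContinuousLinearMap.comp_apply, innerSL_apply_apply, Real.norm_eq_abs] at h4 ht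
    calc _ ≤ _ := h4
      _ ≤ (β / 4 / ‖v‖ * |t|) * ‖v‖ := by gcongr
      _ = _ := by field_simp
  have hdiff : ∀ᶠ t : ℝ in 𝓝 0, DifferentiableAt ℝ φ (u₀ + t • v) := by
    refine hline.eventually ?_
    filter_upwards [hφ.eventually (by norm_num)] with u hu
    exact hu.differentiableAt (by norm_num)
  have hgrow : ∀ᶠ t : ℝ in 𝓝 0,
      ‖φ u₀ - z₀‖ ^ 2 + β * t ^ 2 ≤ ‖φ (u₀ + t • v) - z₀‖ ^ 2 := by
    have hs := (hφ.differentiableAt (by norm_num)).hasFDerivAt.isLittleO.bound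
      (c := κ / 2) (by positivity)
    filter_upwards [hline.eventually h, hline.eventually hs] with t h1 h2
    refine le_trans ?_ h1
    have h3 := hA (t • v)
    simp only [add_sub_cancel_left] at h2
    rw [← norm_neg, neg_sub] at h2
    have h4 := norm_sub_norm_le (fderiv ℝ φ u₀ (t • v)) (φ (u₀ + t • v) - φ u₀)
    have h5 : κ / 2 * ‖t • v‖ ≤ ‖φ (u₀ + t • v) - φ u₀‖ := by linarith
    have h6 := pow_le_pow_left₀ (by positivity) h5 2
    have h7 : β * t ^ 2 = α * (κ / 2 * ‖t • v‖) ^ 2 := by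
      rw [norm_smul, hβ, Real.norm_eq_abs, ← sq_abs t]; ring
    rw [h7]
    gcongr
  obtain ⟨τ, hτ, hball⟩ := Metric.eventually_nhds_iff.1 (hsmall.and (hdiff.and hgrow))
  have hin : ∀ t ∈ Set.Icc (0 : ℝ) (τ / 2), dist t 0 < τ := by
    intro t ht
    rw [Real.dist_0_eq_abs, abs_of_nonneg ht.1]
    linarith [ht.2]
  have hD : ∀ t ∈ Set.Icc (0 : ℝ) (τ / 2), HasDerivAt (fun t : ℝ => ‖φ (u₀ + t • v) - z₀‖ ^ 2)
      (2 * ⟪φ (u₀ + t • v) - z₀, fderiv ℝ φ (u₀ + t • v) v⟫) t := by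
    intro t ht
    have h1 := ((hball (hin t ht)).2.1.hasFDerivAt.comp_hasDerivAt t (hlineD t)).sub_const z₀
    exact h1.norm_sq
  -- By the mean value theorem the increase over `[0, τ/2]` is at most `(β/2)(τ/2)²`, against a
  -- growth of at least `β (τ/2)²`.
  obtain ⟨ξ, hξ, hslope⟩ := exists_hasDerivAt_eq_slope
    (fun t : ℝ => ‖φ (u₀ + t • v) - z₀‖ ^ 2)
    (fun t : ℝ => 2 * ⟪φ (u₀ + t • v) - z₀, fderiv ℝ φ (u₀ + t • v) v⟫)
    (by positivity : (0 : ℝ) < τ / 2)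
    (fun t ht => (hD t ht).continuousAt.continuousWithinAt)
    (fun t ht => hD t (Set.Ioo_subset_Icc_self ht))
  have h1 := (hball (hin ξ (Set.Ioo_subset_Icc_self hξ))).1
  have h2 := (hball (hin (τ / 2) ⟨by positivity, le_rfl⟩)).2.2
  simp only [zero_smul, add_zero, sub_zero] at hslope
  rw [eq_div_iff (by positivity)] at hslope
  rw [abs_of_pos hξ.1] at h1
  have h3 := le_abs_self ⟪φ (u₀ + ξ • v) - z₀, fderiv ℝ φ (u₀ + ξ • v) v⟫
  have h5 : ⟪φ (u₀ + ξ • v) - z₀, fderiv ℝ φ (u₀ + ξ • v) v⟫ ≤ β / 4 * (τ / 2) :=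
    (h3.trans h1).trans (by have := hξ.2.le; gcongr)
  have h4 : 2 * ⟪φ (u₀ + ξ • v) - z₀, fderiv ℝ φ (u₀ + ξ • v) v⟫ * (τ / 2) ≤
      2 * (β / 4 * (τ / 2)) * (τ / 2) := by gcongr
  nlinarith [mul_pos hβpos (pow_pos hτ 2)]

/-- Around a point whose distance to a submanifold grows quadratically away from a projection `x`,
the local projection onto a neighborhood of `x` is unique and of class `C¹`. -/
theorem IsC2Submanifold.eventually_localProjection {m : ℕ} {M : Set (EuclideanSpace ℝ (Fin D))}
    (hM : IsC2Submanifold m M) (hcpt : IsCompact M) {x z₀ : EuclideanSpace ℝ (Fin D)}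
    (hx : x ∈ M) {δ α : ℝ} (hδ : 0 < δ) (hα : 0 < α)
    (h : ∀ y ∈ M ∩ closedBall x δ, ‖x - z₀‖ ^ 2 + α * ‖y - x‖ ^ 2 ≤ ‖y - z₀‖ ^ 2) :
    ∀ᶠ z in 𝓝 z₀, (∃! y, y ∈ projections (M ∩ closedBall x δ) z) ∧
      localProjection M x δ z ∈ ball x δ ∧ ContDiffAt ℝ 1 (localProjection M x δ) z := by
  obtain ⟨φ, u₀, rfl, hφ, hinj, hmap⟩ := hM.exists_chart hx
  have hScpt : IsCompact (M ∩ closedBall (φ u₀) δ) := hcpt.inter_right isClosed_closedBall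
  have hxS : φ u₀ ∈ M ∩ closedBall (φ u₀) δ := ⟨hx, mem_closedBall_self hδ.le⟩
  have hmin : ∀ y ∈ M ∩ closedBall (φ u₀) δ, dist z₀ (φ u₀) ≤ dist z₀ y := by
    intro y hy
    rw [dist_comm, dist_eq_norm, dist_comm, dist_eq_norm]
    exact le_of_sq_le_sq (by nlinarith [h y hy, sq_nonneg ‖y - φ u₀‖]) (norm_nonneg _)
  have hproj₀ : projections (M ∩ closedBall (φ u₀) δ) z₀ ⊆ {φ u₀} := by
    intro y hy
    have h1 : dist z₀ y ≤ dist z₀ (φ u₀) := hy.2.trans_le (infDist_le_dist_of_mem hxS)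
    have h2 := h y hy.1
    rw [dist_comm, dist_eq_norm, dist_comm, dist_eq_norm] at h1
    have h3 := pow_le_pow_left₀ (norm_nonneg _) h1 2
    have h4 : ‖y - φ u₀‖ ^ 2 ≤ 0 := by nlinarith
    have h5 : ‖y - φ u₀‖ = 0 := by nlinarith [sq_nonneg ‖y - φ u₀‖]
    exact sub_eq_zero.1 (norm_eq_zero.1 h5)
  have hnear : ∀ᶠ u in 𝓝 u₀, φ u ∈ M ∩ closedBall (φ u₀) δ := by
    have h1 : ∀ᶠ y in 𝓝[M] (φ u₀), y ∈ M ∩ closedBall (φ u₀) δ :=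
      eventually_mem_nhdsWithin.and
        (eventually_nhdsWithin_of_eventually_nhds (closedBall_mem_nhds _ hδ))
    rwa [← hmap, eventually_map] at h1
  -- `G (z, u) = 0` says that `φ u - z` is normal at `φ u`, which every projection satisfies. `G` is
  -- `C¹` because `φ` is `C²`, and its partial derivative in `u` is invertible at `(z₀, u₀)` by
  -- quadratic growth. The implicit function `ψ` gives the local projection as `φ ∘ ψ`.
  set G : EuclideanSpace ℝ (Fin D) × EuclideanSpace ℝ (Fin m) →
      (EuclideanSpace ℝ (Fin m) →L[ℝ] ℝ) :=
    fun p => (innerSL ℝ (φ p.2 - p.1)).comp (fderiv ℝ φ p.2) with hG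
  have hG0 : G (z₀, u₀) = 0 := by
    ext v
    refine inner_fderiv_eq_zero_of_dist_le (hφ.differentiableAt (by norm_num)) ?_ v
    filter_upwards [hnear] with u hu using hmin _ hu
  have hGC : ContDiffAt ℝ 1 G (z₀, u₀) := by
    have h1 : ContDiffAt ℝ 1 (fun p : EuclideanSpace ℝ (Fin D) × EuclideanSpace ℝ (Fin m) =>
        fderiv ℝ φ p.2) (z₀, u₀) :=
      ContDiffAt.comp (g := fderiv ℝ φ) (f := Prod.snd) (z₀, u₀)
        (hφ.fderiv_right (by norm_num)) contDiffAt_snd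
    have h2 : ContDiffAt ℝ 1 (fun p : EuclideanSpace ℝ (Fin D) × EuclideanSpace ℝ (Fin m) =>
        φ p.2 - p.1) (z₀, u₀) :=
      (ContDiffAt.comp (g := φ) (f := Prod.snd) (z₀, u₀)
        (hφ.of_le (by norm_num)) contDiffAt_snd).sub contDiffAt_fst
    exact ((innerSL ℝ).contDiff.contDiffAt.comp _ h2).clm_comp h1
  have hinv : (fderiv ℝ G (z₀, u₀) ∘L
      .inr ℝ (EuclideanSpace ℝ (Fin D)) (EuclideanSpace ℝ (Fin m))).IsInvertible := by
    refine isInvertible_of_injective_dual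
      (injective_fderiv_inner_of_quadratic_growth hφ hinj hα (z₀ := z₀) ?_ ?_ hG0)
    · filter_upwards [hnear] with u hu using h _ hu
    · have h1 : HasFDerivAt G (fderiv ℝ G (z₀, u₀)) (z₀, u₀) :=
        (hGC.differentiableAt (by norm_num)).hasFDerivAt
      exact h1.comp u₀ (hasFDerivAt_prodMk_right z₀ u₀)
  set ψ := hGC.implicitFunction (by norm_num) hinv with hψ
  have hψ0 : ψ z₀ = u₀ := hGC.implicitFunction_apply_self (by norm_num) hinv
  have hψC : ContDiffAt ℝ 1 ψ z₀ := hGC.contDiffAt_implicitFunction (by norm_num) hinv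
  have hψiff := hGC.eventually_apply_eq_iff_implicitFunction (by norm_num) hinv
  rw [hG0, nhds_prod_eq, eventually_prod_iff] at hψiff
  obtain ⟨pz, hpz, pu, hpu, hiff⟩ := hψiff
  have hdiff : ∀ᶠ u in 𝓝 u₀, DifferentiableAt ℝ φ u := by
    filter_upwards [hφ.eventually (by norm_num)] with u hu
    exact hu.differentiableAt (by norm_num)
  have himg : φ '' {u | pu u ∧ DifferentiableAt ℝ φ u ∧
      ∀ᶠ w in 𝓝 u, φ w ∈ M ∩ closedBall (φ u₀) δ} ∈ 𝓝[M] (φ u₀) := by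
    rw [← hmap]
    exact image_mem_map
      (by filter_upwards [hpu, hdiff, hnear.eventually_nhds] with u a b c using ⟨a, b, c⟩)
  obtain ⟨W, hW, hxW, hsub⟩ := mem_nhdsWithin.1 himg
  have hev : ∀ᶠ z in 𝓝 z₀, projections (M ∩ closedBall (φ u₀) δ) z ⊆ W ∩ ball (φ u₀) δ :=
    eventually_projections_subset hScpt (hW.inter isOpen_ball) (hproj₀.trans (by
      rintro _ rfl
      exact ⟨hxW, mem_ball_self hδ⟩))
  have huniq : ∀ᶠ z in 𝓝 z₀, ∀ y ∈ projections (M ∩ closedBall (φ u₀) δ) z,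
      y = φ (ψ z) ∧ y ∈ ball (φ u₀) δ := by
    filter_upwards [hev, hpz] with z hz hpz y hy
    refine ⟨?_, (hz hy).2⟩
    obtain ⟨u, ⟨hu1, hu2, hu3⟩, rfl⟩ := hsub ⟨(hz hy).1, hy.1.1⟩
    have h1 : G (z, u) = 0 := by
      ext v
      refine inner_fderiv_eq_zero_of_dist_le hu2 ?_ v
      filter_upwards [hu3] with w hw
      rw [hy.2]
      exact infDist_le_dist_of_mem hw
    have h2 : ψ z = u := (hiff hpz hu1).1 h1
    rw [h2]
  have hex : ∀ᶠ z in 𝓝 z₀, (∃! y, y ∈ projections (M ∩ closedBall (φ u₀) δ) z) ∧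
      localProjection M (φ u₀) δ z = φ (ψ z) ∧ localProjection M (φ u₀) δ z ∈ ball (φ u₀) δ := by
    filter_upwards [huniq] with z hz
    obtain ⟨y, hy⟩ := projections_nonempty hScpt ⟨_, hxS⟩ z
    have h1 : ∃! y, y ∈ projections (M ∩ closedBall (φ u₀) δ) z :=
      ⟨y, hy, fun y' hy' => (hz y' hy').1.trans (hz y hy).1.symm⟩
    exact ⟨h1, hz _ (localProjection_mem_projections h1)⟩
  have hC : ContDiffAt ℝ 1 (localProjection M (φ u₀) δ) z₀ := by
    have h1 : ContDiffAt ℝ 1 (φ ∘ ψ) z₀ :=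
      ContDiffAt.comp z₀ (hψ0.symm ▸ hφ.of_le (by norm_num)) hψC
    refine h1.congr_of_eventuallyEq ?_
    filter_upwards [hex] with z hz using hz.2.1
  filter_upwards [hex, hC.eventually (by norm_num)] with z h1 h2 using ⟨h1.1, h1.2.2, h2⟩

theorem PropertyP1.finite_projections {M : Set (EuclideanSpace ℝ (Fin D))} (hP1 : PropertyP1 M)
    {z₀ : EuclideanSpace ℝ (Fin D)} (hz₀ : z₀ ∈ criticalPoints M) : (projections M z₀).Finite :=
  finite_set_of_fin_dim_affineIndependent ℝ (hP1 z₀ hz₀).1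

/-- The projections of `z₀` being finite in number, one `δ` below all radii of (P3) and one
neighborhood of `z₀` serve them all. By semicontinuity the projections of a nearby `z` fall in the
balls `B(x, δ)`, where they are local projections. -/
theorem IsC2Submanifold.exists_localProjectionsWellDefined {m : ℕ}
    {M : Set (EuclideanSpace ℝ (Fin D))} (hM : IsC2Submanifold m M) (hcpt : IsCompact M)
    (hP1 : PropertyP1 M) (hP3 : PropertyP3 M) {z₀ : EuclideanSpace ℝ (Fin D)}
    (hz₀ : z₀ ∈ criticalPoints M) :
    ∃ δ' > (0 : ℝ), ∃ δ > (0 : ℝ), LocalProjectionsWellDefined M z₀ δ' δ := by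
  have hfin := hP1.finite_projections hz₀
  have h1 : ∀ᶠ δ : ℝ in 𝓝[>] 0, ∀ x ∈ projections M z₀, ∃ α > (0 : ℝ),
      ∀ y ∈ M ∩ closedBall x δ, ‖x - z₀‖ ^ 2 + α * ‖y - x‖ ^ 2 ≤ ‖y - z₀‖ ^ 2 := by
    rw [eventually_all_finite hfin]
    intro x hx
    obtain ⟨δ, hδ, α, hα, h⟩ := hP3 z₀ hz₀ x hx
    filter_upwards [Ioo_mem_nhdsGT hδ] with ε hε
    exact ⟨α, hα, fun y hy => h y ⟨hy.1, closedBall_subset_ball hε.2 hy.2⟩⟩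
  obtain ⟨δ, h2, hδ⟩ := (h1.and eventually_mem_nhdsWithin).exists
  have hδ : 0 < δ := hδ
  have h3 : ∀ᶠ z in 𝓝 z₀, ∀ x ∈ projections M z₀,
      (∃! y, y ∈ projections (M ∩ closedBall x δ) z) ∧
      localProjection M x δ z ∈ ball x δ ∧ ContDiffAt ℝ 1 (localProjection M x δ) z := by
    rw [eventually_all_finite hfin]
    intro x hx
    obtain ⟨α, hα, h⟩ := h2 x hx
    exact hM.eventually_localProjection hcpt hx.1 hδ hα h
  have h4 : ∀ᶠ z in 𝓝 z₀, projections M z ⊆ ⋃ x ∈ projections M z₀, ball x δ :=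
    eventually_projections_subset hcpt (isOpen_biUnion fun _ _ => isOpen_ball)
      fun x hx => Set.mem_biUnion hx (mem_ball_self hδ)
  obtain ⟨δ', hδ', hball⟩ := Metric.eventually_nhds_iff_ball.1 (h3.and h4)
  refine ⟨δ', hδ', δ, hδ, ⟨fun x hx z hz => ((hball z hz).1 x hx).1,
    fun x hx z hz => ((hball z hz).1 x hx).2.1,
    fun x hx z hz => ((hball z hz).1 x hx).2.2.contDiffWithinAt, fun z hz y hy => ?_⟩⟩
  obtain ⟨x, hx, hyx⟩ := Set.mem_iUnion₂.1 ((hball z hz).2 hy)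
  exact ⟨x, hx, (eq_localProjection ((hball z hz).1 x hx).1
    (mem_projections_inter hy (ball_subset_closedBall hyx))).symm⟩

theorem LocalProjectionsWellDefined.mono {M : Set (EuclideanSpace ℝ (Fin D))}
    {z₀ : EuclideanSpace ℝ (Fin D)} {δ₁ δ₂ δ : ℝ} (h : LocalProjectionsWellDefined M z₀ δ₂ δ)
    (hle : δ₁ ≤ δ₂) : LocalProjectionsWellDefined M z₀ δ₁ δ where
  existsUnique x hx z hz := h.existsUnique x hx z (ball_subset_ball hle hz)
  mem_ball x hx z hz := h.mem_ball x hx z (ball_subset_ball hle hz)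
  contDiffOn x hx := (h.contDiffOn x hx).mono (ball_subset_ball hle)
  projections_subset z hz := h.projections_subset z (ball_subset_ball hle hz)

/-! ### Alternating maps and Gram determinants -/

section Alternating

variable {ι V W : Type*} [DecidableEq ι] [Fintype ι] [AddCommGroup V] [Module ℝ V]
  [AddCommGroup W] [Module ℝ W]

/-- Replacing a vector by a linear combination of the family multiplies an alternating map by the
coefficient of that vector. -/
theorem alternatingMap_update_sum_smul (f : V [⋀^ι]→ₗ[ℝ] W) (q : ι → V) (lam : ι → ℝ) (i₀ : ι) :
    f (Function.update q i₀ (∑ k, lam k • q k)) = lam i₀ • f q := by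
  rw [f.map_update_sum, Finset.sum_eq_single i₀]
  · rw [f.map_update_smul, Function.update_eq_self]
  · intro k _ hk
    rw [f.map_update_smul, f.map_update_self _ hk.symm, smul_zero]
  · simp

/-- Given a linear relation between the vectors of a family, replacing one or the other of them
by `w` changes an alternating map by the ratio of their coefficients. -/
theorem alternatingMap_smul_update_comm (f : V [⋀^ι]→ₗ[ℝ] W) {v : ι → V} {lam : ι → ℝ}
    (h : ∑ k, lam k • v k = 0) (i i₀ : ι) (w : V) :
    lam i₀ • f (Function.update v i w) = lam i • f (Function.update v i₀ w) := by
  rcases eq_or_ne i i₀ with rfl | hne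
  · rfl
  -- With the null combination put in slot `i₀`, every term other than `k = i` and `k = i₀` contains
  -- a vector twice, and the term `k = i` is a transposition of `v` with `w` in slot `i₀`.
  have h1 : f (Function.update (Function.update v i w) i₀ (∑ k, lam k • v k)) = 0 := by
    rw [h]
    exact f.map_coord_zero i₀ (by simp)
  rw [f.map_update_sum, Finset.sum_eq_add i i₀ hne] at h1
  · have h2 : Function.update (Function.update v i w) i₀ (v i) =
        Function.update v i₀ w ∘ Equiv.swap i i₀ := by
      ext k
      rcases eq_or_ne k i with rfl | hki
      · simp [hne]
      rcases eq_or_ne k i₀ with rfl | hki₀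
      · simp [hne]
      · simp [hki, hki₀, Equiv.swap_apply_of_ne_of_ne]
    have h3 : Function.update (Function.update v i w) i₀ (v i₀) = Function.update v i w := by
      rw [Function.update_eq_self_iff, Function.update_of_ne hne.symm]
    rw [f.map_update_smul, f.map_update_smul, h2, h3, f.map_swap _ hne, smul_neg] at h1
    exact (neg_add_eq_zero.1 h1).symm
  · intro k _ hk
    rw [f.map_update_smul]
    rw [f.map_eq_zero_of_eq (i := k) (j := i₀) _ _ hk.2, smul_zero]
    rw [Function.update_of_ne hk.2, Function.update_of_ne hk.1, Function.update_self]
  · simp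
  · simp

end Alternating

/-- The matrix whose columns are the coordinates of the vectors `v k`. -/
def colMatrix {s : ℕ} (v : Fin s → EuclideanSpace ℝ (Fin D)) : Matrix (Fin D) (Fin s) ℝ :=
  Matrix.of fun a k => v k a

theorem replacedMatrix_eq_colMatrix {s : ℕ} (x : Fin s → EuclideanSpace ℝ (Fin D))
    (z₀ : EuclideanSpace ℝ (Fin D)) (i : Fin s) (w : EuclideanSpace ℝ (Fin D)) :
    replacedMatrix x z₀ i w = colMatrix (Function.update (fun k => x k - z₀) i w) := by
  ext a k
  rcases eq_or_ne k i with rfl | hk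
  · simp [replacedMatrix, colMatrix]
  · simp [replacedMatrix, colMatrix, hk]

theorem colMatrix_transpose_mul_self {s : ℕ} (v : Fin s → EuclideanSpace ℝ (Fin D)) :
    (colMatrix v).transpose * colMatrix v = Matrix.gram ℝ v := by
  ext i j
  simp [colMatrix, Matrix.mul_apply, Matrix.gram_apply, PiLp.inner_apply, mul_comm]

/-- The alternating map `v ↦ det ([v₁, …, v_s]ᵀ N)`. -/
def detPairing {s : ℕ} (N : Matrix (Fin D) (Fin s) ℝ) :
    EuclideanSpace ℝ (Fin D) [⋀^Fin s]→ₗ[ℝ] ℝ :=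
  Matrix.detRowAlternating.compLinearMap
    (N.vecMulLinear ∘ₗ (WithLp.linearEquiv 2 ℝ (Fin D → ℝ)).toLinearMap)

theorem detPairing_apply {s : ℕ} (N : Matrix (Fin D) (Fin s) ℝ)
    (v : Fin s → EuclideanSpace ℝ (Fin D)) :
    detPairing N v = ((colMatrix v).transpose * N).det := rfl

theorem detPairing_comm {s : ℕ} (v w : Fin s → EuclideanSpace ℝ (Fin D)) :
    detPairing (colMatrix v) w = detPairing (colMatrix w) v :=
  det_replacedMatrix_comm _ _

theorem detPairing_self {s : ℕ} (v : Fin s → EuclideanSpace ℝ (Fin D)) :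
    detPairing (colMatrix v) v = (Matrix.gram ℝ v).det := by
  rw [detPairing_apply, colMatrix_transpose_mul_self]

/-- The Gram determinant pairs the family with itself, so the coefficient comes out once from each
side. -/
theorem det_gram_update_sum_smul {s : ℕ} (q : Fin s → EuclideanSpace ℝ (Fin D))
    (lam : Fin s → ℝ) (i₀ : Fin s) :
    (Matrix.gram ℝ (Function.update q i₀ (∑ k, lam k • q k))).det =
      lam i₀ ^ 2 * (Matrix.gram ℝ q).det := by
  rw [← detPairing_self, alternatingMap_update_sum_smul, detPairing_comm,
    alternatingMap_update_sum_smul, detPairing_self, smul_eq_mul, smul_eq_mul, sq, mul_assoc]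

/-! ### Barycentric coordinates of a critical point -/

/-- The point `z₀` lies in the relative interior of the non-degenerate simplex with vertices `x`,
and `lam` are its barycentric coordinates. -/
structure IsInteriorBarycenter {s : ℕ} (x : Fin s → EuclideanSpace ℝ (Fin D))
    (lam : Fin s → ℝ) (z₀ : EuclideanSpace ℝ (Fin D)) : Prop where
  affineIndependent : AffineIndependent ℝ x
  pos : ∀ i, 0 < lam i
  sum_eq_one : ∑ i, lam i = 1
  sum_smul : ∑ i, lam i • x i = z₀

theorem eq_of_sum_smul_eq {s : ℕ} {x : Fin s → EuclideanSpace ℝ (Fin D)}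
    (hx : AffineIndependent ℝ x) {w w' : Fin s → ℝ} (h1 : ∑ i, w i = ∑ i, w' i)
    (h2 : ∑ i, w i • x i = ∑ i, w' i • x i) : w = w' := by
  ext i
  have := affineIndependent_iff.1 hx Finset.univ (fun i => w i - w' i)
    (by rw [Finset.sum_sub_distrib, h1, sub_self])
    (by simp_rw [sub_smul]; rw [Finset.sum_sub_distrib, h2, sub_self]) i (Finset.mem_univ i)
  linarith

/-- The last clause matters when `p` lists the local projections and `T` is the set of true
projections: a nonzero weight certifies a local projection as a true one. -/
theorem exists_weights_of_mem_convexHull {s : ℕ} {p : Fin s → EuclideanSpace ℝ (Fin D)}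
    {T : Set (EuclideanSpace ℝ (Fin D))} (hT : T ⊆ Set.range p) {c : EuclideanSpace ℝ (Fin D)}
    (hc : c ∈ convexHull ℝ T) :
    ∃ w : Fin s → ℝ, (∀ i, 0 ≤ w i) ∧ ∑ i, w i = 1 ∧ ∑ i, w i • p i = c ∧
      ∀ i, w i ≠ 0 → p i ∈ T := by
  have hconv : Convex ℝ {c | ∃ w : Fin s → ℝ, (∀ i, 0 ≤ w i) ∧ ∑ i, w i = 1 ∧
      ∑ i, w i • p i = c ∧ ∀ i, w i ≠ 0 → p i ∈ T} := by
    rintro _ ⟨w, hw0, hw1, rfl, hw⟩ _ ⟨w', hw'0, hw'1, rfl, hw'⟩ a b ha hb hab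
    refine ⟨fun i => a * w i + b * w' i, fun i => ?_, ?_, ?_, fun i hi => ?_⟩
    · have := hw0 i; have := hw'0 i; positivity
    · rw [Finset.sum_add_distrib, ← Finset.mul_sum, ← Finset.mul_sum, hw1, hw'1]; simpa using hab
    · simp_rw [add_smul, mul_smul]
      rw [Finset.sum_add_distrib, ← Finset.smul_sum, ← Finset.smul_sum]
    · by_contra hiT
      have h1 : w i = 0 := by by_contra h; exact hiT (hw i h)
      have h2 : w' i = 0 := by by_contra h; exact hiT (hw' i h)
      simp [h1, h2] at hi
  refine convexHull_min ?_ hconv hc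
  intro y hy
  obtain ⟨j, rfl⟩ := hT hy
  classical
  refine ⟨Pi.single j 1, fun i => ?_, by simp, ?_, fun i hi => ?_⟩
  · rcases eq_or_ne i j with rfl | h
    · simp
    · simp [h]
  · simp [Pi.single_apply, ite_smul]
  · rcases eq_or_ne i j with rfl | h
    · exact hy
    · simp [h] at hi

/-- The segment from `x i` to `z₀` can be prolonged a little beyond `z₀` inside the simplex. At the
prolonged point the weight of `x i` is `(1 + t) * lam i - t ≥ 0` with `t > 0`, which forces `lam i >
0`. -/
theorem PropertyP1.exists_isInteriorBarycenter {M : Set (EuclideanSpace ℝ (Fin D))}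
    (hP1 : PropertyP1 M) {z₀ : EuclideanSpace ℝ (Fin D)} (hz₀ : z₀ ∈ criticalPoints M) {s : ℕ}
    {x : Fin s → EuclideanSpace ℝ (Fin D)} (hx : EnumeratesProjections M z₀ x) :
    ∃ lam, IsInteriorBarycenter x lam z₀ := by
  obtain ⟨hinj, hrange⟩ := hx
  obtain ⟨haff, hint⟩ := hP1 z₀ hz₀
  have hxaff : AffineIndependent ℝ x :=
    haff.comp_embedding ⟨fun i => (⟨x i, hrange ▸ Set.mem_range_self i⟩ : projections M z₀),
      fun i j h => hinj (congrArg Subtype.val h)⟩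
  obtain ⟨lam, hlam0, hlam1, hlam, -⟩ :=
    exists_weights_of_mem_convexHull hrange.ge (intrinsicInterior_subset hint)
  refine ⟨lam, hxaff, fun i => ?_, hlam1, hlam⟩
  obtain ⟨y, hy, hyz⟩ := mem_intrinsicInterior.1 hint
  have hxi : x i ∈ affineSpan ℝ (convexHull ℝ (projections M z₀)) :=
    subset_affineSpan ℝ _ (subset_convexHull ℝ _ (hrange.le (Set.mem_range_self i)))
  have hzi : z₀ ∈ affineSpan ℝ (convexHull ℝ (projections M z₀)) :=
    subset_affineSpan ℝ _ (intrinsicInterior_subset hint)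
  let γ : ℝ → affineSpan ℝ (convexHull ℝ (projections M z₀)) :=
    fun t => ⟨AffineMap.lineMap (x i) z₀ (1 + t), AffineMap.lineMap_mem _ hxi hzi⟩
  have hγ : Continuous γ := by
    refine Continuous.subtype_mk ?_ _
    simp only [AffineMap.lineMap_apply_module]
    fun_prop
  have hγ0 : γ 0 = y := Subtype.ext (by simp [γ, hyz])
  have hev : ∀ᶠ t in 𝓝 (0 : ℝ), γ t ∈ interior
      ((↑) ⁻¹' (convexHull ℝ (projections M z₀)) : Set (affineSpan ℝ (convexHull ℝ _))) :=
    hγ.continuousAt.eventually (isOpen_interior.mem_nhds (hγ0 ▸ hy))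
  obtain ⟨t, ht, htpos⟩ := ((hev.filter_mono nhdsWithin_le_nhds).and
    (eventually_mem_nhdsWithin (s := Set.Ioi (0 : ℝ)))).exists
  have htpos : 0 < t := htpos
  have hmem : AffineMap.lineMap (x i) z₀ (1 + t) ∈ convexHull ℝ (projections M z₀) :=
    (interior_subset ht :)
  obtain ⟨w, hw0, hw1, hw, -⟩ := exists_weights_of_mem_convexHull hrange.ge hmem
  have heq : w = fun k => (1 + t) * lam k + Pi.single (M := fun _ => ℝ) i (-t) k := by
    refine eq_of_sum_smul_eq hxaff ?_ ?_
    · rw [Finset.sum_add_distrib, ← Finset.mul_sum, hlam1, hw1]; simp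
    · simp_rw [add_smul, mul_smul]
      rw [Finset.sum_add_distrib, ← Finset.smul_sum, hlam, hw, AffineMap.lineMap_apply_module]
      simp [Pi.single_apply, ite_smul]
      abel
  have hwi := hw0 i
  rw [heq] at hwi
  simp only [Pi.single_eq_same] at hwi
  by_contra hle
  have : lam i = 0 := le_antisymm (not_lt.1 hle) (hlam0 i)
  rw [this] at hwi
  linarith

theorem mem_vectorSpan_range_iff {s : ℕ} {x : Fin s → EuclideanSpace ℝ (Fin D)} (i₀ : Fin s)
    {a : EuclideanSpace ℝ (Fin D)} :
    a ∈ vectorSpan ℝ (Set.range x) ↔ ∃ d : Fin s → ℝ, ∑ i, d i = 0 ∧ ∑ i, d i • x i = a := by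
  rw [vectorSpan_range_eq_span_range_vsub_right ℝ x i₀, Submodule.mem_span_range_iff_exists_fun]
  constructor
  · rintro ⟨c, rfl⟩
    refine ⟨fun i => c i - Pi.single (M := fun _ => ℝ) i₀ (∑ k, c k) i, by simp, ?_⟩
    simp [sub_smul, smul_sub, Pi.single_apply, ite_smul, Finset.sum_smul]
  · rintro ⟨d, hd, rfl⟩
    refine ⟨d, ?_⟩
    simp only [vsub_eq_sub, smul_sub, Finset.sum_sub_distrib]
    rw [← Finset.sum_smul, hd, zero_smul, sub_zero]

namespace IsInteriorBarycenter

variable {s : ℕ} {x : Fin s → EuclideanSpace ℝ (Fin D)} {lam : Fin s → ℝ}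
  {z₀ : EuclideanSpace ℝ (Fin D)}

theorem sum_smul_sub (h : IsInteriorBarycenter x lam z₀) : ∑ i, lam i • (x i - z₀) = 0 := by
  simp only [smul_sub, Finset.sum_sub_distrib]
  rw [h.sum_smul, ← Finset.sum_smul, h.sum_eq_one, one_smul, sub_self]

theorem nonempty (h : IsInteriorBarycenter x lam z₀) : Nonempty (Fin s) := by
  by_contra hs
  rw [not_nonempty_iff] at hs
  simpa using h.sum_eq_one

/-- The relations between the `x k - z₀` are the multiples of `lam`, whose entries are all nonzero.
Dropping the `i₀`-th vector therefore leaves a basis of `E`, which `a` extends exactly when it lies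
outside `E`. -/
theorem linearIndependent_update_iff (h : IsInteriorBarycenter x lam z₀) (i₀ : Fin s)
    (a : EuclideanSpace ℝ (Fin D)) :
    LinearIndependent ℝ (Function.update (fun k => x k - z₀) i₀ a) ↔
      a ∉ vectorSpan ℝ (Set.range x) := by
  have hsum : ∀ g : Fin s → ℝ, ∑ i, g i • Function.update (fun k => x k - z₀) i₀ a i =
      g i₀ • a + ∑ i, Function.update g i₀ 0 i • (x i - z₀) := by
    intro g
    rw [← Finset.add_sum_erase _ _ (Finset.mem_univ i₀),
      ← Finset.add_sum_erase (a := i₀) _ (fun i => Function.update g i₀ 0 i • (x i - z₀))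
        (Finset.mem_univ i₀)]
    simp only [Function.update_self, zero_smul, zero_add]
    congr 1
    refine Finset.sum_congr rfl fun i hi => ?_
    rw [Function.update_of_ne (Finset.ne_of_mem_erase hi),
      Function.update_of_ne (Finset.ne_of_mem_erase hi)]
  have hcomb : ∀ g : Fin s → ℝ, ∑ i, g i • (x i - z₀) =
      ∑ i, (g i - (∑ k, g k) * lam i) • x i := by
    intro g
    simp only [smul_sub, Finset.sum_sub_distrib, sub_smul, mul_smul]
    rw [← Finset.smul_sum, h.sum_smul, ← Finset.sum_smul]
  have hcomb0 : ∀ g : Fin s → ℝ, ∑ i, (g i - (∑ k, g k) * lam i) = 0 := by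
    intro g
    rw [Finset.sum_sub_distrib, ← Finset.mul_sum, h.sum_eq_one, mul_one, sub_self]
  rw [Fintype.linearIndependent_iff]
  constructor
  · intro hli ha
    obtain ⟨d, hd0, rfl⟩ := (mem_vectorSpan_range_iff i₀).1 ha
    have hd : ∑ i, d i • (x i - z₀) = ∑ i, d i • x i := by rw [hcomb, hd0]; simp
    -- eliminate the vector of index `i₀` by means of the relation between the `x i - z₀`
    set e : Fin s → ℝ := fun i => d i - d i₀ / lam i₀ * lam i with he
    have he0 : e i₀ = 0 := by simp [he, (h.pos i₀).ne']
    have he1 : ∑ i, e i • (x i - z₀) = ∑ i, d i • x i := by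
      simp only [he, sub_smul, Finset.sum_sub_distrib, mul_smul]
      rw [← Finset.smul_sum, h.sum_smul_sub, smul_zero, sub_zero, hd]
    have h1 := hli (Function.update e i₀ (-1)) (by
      rw [hsum]
      have : Function.update (Function.update e i₀ (-1)) i₀ 0 = e := by
        rw [Function.update_idem, ← he0, Function.update_eq_self]
      rw [this, he1]
      simp) i₀
    simp at h1
  · intro ha g hg
    rw [hsum] at hg
    have hmem : ∑ i, Function.update g i₀ 0 i • (x i - z₀) ∈ vectorSpan ℝ (Set.range x) :=
      (mem_vectorSpan_range_iff i₀).2 ⟨_, hcomb0 _, (hcomb _).symm⟩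
    have hg0 : g i₀ = 0 := by
      by_contra hne
      refine ha ?_
      have h1 : g i₀ • a = -∑ i, Function.update g i₀ 0 i • (x i - z₀) :=
        eq_neg_of_add_eq_zero_left hg
      have h2 : g i₀ • a ∈ vectorSpan ℝ (Set.range x) := h1 ▸ Submodule.neg_mem _ hmem
      exact (Submodule.smul_mem_iff _ hne).1 h2
    have hupd : Function.update g i₀ 0 = g := by rw [← hg0, Function.update_eq_self]
    rw [hg0, zero_smul, zero_add, hupd, hcomb] at hg
    -- So `g` is a multiple of `lam`; it vanishes at `i₀`, where `lam` does not.
    have h3 := eq_of_sum_smul_eq h.affineIndependent (w' := fun _ => 0)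
      ((hcomb0 g).trans (by simp)) (hg.trans (by simp))
    have h4 := congrFun h3 i₀
    simp only [hg0, zero_sub, neg_eq_zero, mul_eq_zero, (h.pos i₀).ne',
      or_false] at h4
    intro i
    have h5 := congrFun h3 i
    simpa [h4] using h5

theorem det_gram_update_eq_zero_iff (h : IsInteriorBarycenter x lam z₀) (i₀ : Fin s)
    (a : EuclideanSpace ℝ (Fin D)) :
    (Matrix.gram ℝ (Function.update (fun k => x k - z₀) i₀ a)).det = 0 ↔
      a ∈ vectorSpan ℝ (Set.range x) := by
  rw [← not_iff_not, ← Ne, Matrix.det_gram_ne_zero_iff_linearIndependent,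
    h.linearIndependent_update_iff]

/-- Moving every replaced column to position `i₀` makes the sum collapse by multilinearity. This is
done in each of the two arguments of the pairing, whence the square. -/
theorem sq_mul_sum_det (h : IsInteriorBarycenter x lam z₀) (i₀ : Fin s)
    (w : Fin s → EuclideanSpace ℝ (Fin D)) :
    lam i₀ ^ 2 * ∑ i, ∑ j, ((replacedMatrix x z₀ i (w i)).transpose *
        replacedMatrix x z₀ j (w j)).det =
      (Matrix.gram ℝ (Function.update (fun k => x k - z₀) i₀ (∑ i, lam i • w i))).det := by
  have hone : ∀ f : EuclideanSpace ℝ (Fin D) [⋀^Fin s]→ₗ[ℝ] ℝ,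
      lam i₀ * ∑ i, f (Function.update (fun k => x k - z₀) i (w i)) =
        f (Function.update (fun k => x k - z₀) i₀ (∑ i, lam i • w i)) := by
    intro f
    rw [Finset.mul_sum, f.map_update_sum]
    refine Finset.sum_congr rfl fun i _ => ?_
    rw [f.map_update_smul]
    exact alternatingMap_smul_update_comm f h.sum_smul_sub i i₀ (w i)
  simp only [replacedMatrix_eq_colMatrix, ← detPairing_apply]
  rw [Finset.sum_comm, sq, mul_assoc, Finset.mul_sum]
  simp_rw [hone, detPairing_comm _ (Function.update (fun k => x k - z₀) i₀ _)]
  rw [hone, detPairing_self]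

end IsInteriorBarycenter

/-! ### Transversal non-degeneracy and the quadratic form -/

theorem EnumeratesProjections.orthDirections_eq {M : Set (EuclideanSpace ℝ (Fin D))} {s : ℕ}
    {x : Fin s → EuclideanSpace ℝ (Fin D)} {z₀ : EuclideanSpace ℝ (Fin D)}
    (hx : EnumeratesProjections M z₀ x) :
    orthDirections M z₀ = (vectorSpan ℝ (Set.range x))ᗮ := by
  rw [orthDirections, hx.2]

/-- The derivative at `z₀`, in the direction `h`, of `z ↦ ∑ λ_i p_i(z) - z`. -/
def meanDisplacement (M : Set (EuclideanSpace ℝ (Fin D))) (δ : ℝ) {s : ℕ}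
    (x : Fin s → EuclideanSpace ℝ (Fin D)) (lam : Fin s → ℝ) (z₀ : EuclideanSpace ℝ (Fin D)) :
    EuclideanSpace ℝ (Fin D) →L[ℝ] EuclideanSpace ℝ (Fin D) :=
  ∑ i, lam i • (fderiv ℝ (localProjection M (x i) δ) z₀ - .id ℝ _)

theorem meanDisplacement_apply (M : Set (EuclideanSpace ℝ (Fin D))) (δ : ℝ) {s : ℕ}
    (x : Fin s → EuclideanSpace ℝ (Fin D)) (lam : Fin s → ℝ) (z₀ h : EuclideanSpace ℝ (Fin D)) :
    meanDisplacement M δ x lam z₀ h =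
      ∑ i, lam i • (fderiv ℝ (localProjection M (x i) δ) z₀ h - h) := by
  simp [meanDisplacement]

/-- No direction orthogonal to the simplex of projections is displaced, in the mean, along the
simplex only. -/
def IsTransversallyNondegenerate (M : Set (EuclideanSpace ℝ (Fin D))) (δ : ℝ) {s : ℕ}
    (x : Fin s → EuclideanSpace ℝ (Fin D)) (lam : Fin s → ℝ) (z₀ : EuclideanSpace ℝ (Fin D)) :
    Prop :=
  ∀ h ∈ (vectorSpan ℝ (Set.range x))ᗮ,
    meanDisplacement M δ x lam z₀ h ∈ vectorSpan ℝ (Set.range x) → h = 0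

theorem IsInteriorBarycenter.simplexForm_nondegenerate_iff {M : Set (EuclideanSpace ℝ (Fin D))}
    {δ : ℝ} {s : ℕ} {x : Fin s → EuclideanSpace ℝ (Fin D)} {lam : Fin s → ℝ}
    {z₀ : EuclideanSpace ℝ (Fin D)} (h : IsInteriorBarycenter x lam z₀)
    (hx : EnumeratesProjections M z₀ x) :
    (simplexForm M δ x z₀).Nondegenerate ↔ IsTransversallyNondegenerate M δ x lam z₀ := by
  obtain ⟨i₀⟩ := h.nonempty
  have hform : ∀ k, lam i₀ ^ 2 * simplexForm M δ x z₀ k = (Matrix.gram ℝ (Function.update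
      (fun k => x k - z₀) i₀ (meanDisplacement M δ x lam z₀ k))).det := by
    intro k
    rw [simplexForm_apply, meanDisplacement_apply]
    exact h.sq_mul_sum_det i₀ _
  have hlam : lam i₀ ^ 2 ≠ 0 := pow_ne_zero 2 (h.pos i₀).ne'
  rw [QuadraticMap.nondegenerate_iff_radical_eq_bot, Submodule.eq_bot_iff]
  constructor
  · intro hrad k hk hmem
    have hk' : k ∈ orthDirections M z₀ := hx.orthDirections_eq ▸ hk
    refine congrArg Subtype.val (hrad ⟨k, hk'⟩ ?_)
    rw [QuadraticMap.mem_radical_iff']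
    -- When the displacement lies in `E`, the replaced family is dependent and every alternating map
    -- kills it. A zero of the form is thus already in its radical.
    have hzero : ∀ f : EuclideanSpace ℝ (Fin D) [⋀^Fin s]→ₗ[ℝ] ℝ, f (Function.update
        (fun k => x k - z₀) i₀ (meanDisplacement M δ x lam z₀ k)) = 0 := fun f =>
      f.map_linearDependent _ fun hli => (h.linearIndependent_update_iff i₀ _).1 hli hmem
    refine ⟨mul_left_cancel₀ hlam ?_, fun n => mul_left_cancel₀ hlam ?_⟩
    · rw [hform, mul_zero, ← detPairing_self, hzero]
    · rw [hform, hform, Submodule.coe_add, map_add, ← detPairing_self, AlternatingMap.map_update_add,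
        hzero, zero_add, detPairing_comm, AlternatingMap.map_update_add, hzero, zero_add,
        detPairing_self]
  · intro hN k hk
    rw [QuadraticMap.mem_radical_iff'] at hk
    have h1 := hform k
    rw [hk.1, mul_zero, eq_comm, h.det_gram_update_eq_zero_iff] at h1
    exact Subtype.ext (hN k (hx.orthDirections_eq ▸ k.2) h1)

/-! ### Volumes of simplices -/

/-- The standard simplex of `ℝˢ`, with the origin among its vertices. -/
def cornerSimplex (s : ℕ) : Set (EuclideanSpace ℝ (Fin s)) :=
  convexHull ℝ (insert 0 (Set.range (EuclideanSpace.basisFun (Fin s) ℝ)))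

theorem volume_real_cornerSimplex_pos (s : ℕ) :
    0 < (volume : Measure (EuclideanSpace ℝ (Fin s))).real (cornerSimplex s) := by
  refine ENNReal.toReal_pos (ne_of_gt ?_) ?_
  · have hne : (interior (cornerSimplex s)).Nonempty := by
      rw [cornerSimplex, interior_convexHull_nonempty_iff_affineSpan_eq_top]
      refine SetLike.coe_injective ?_
      rw [affineSpan_insert_zero]
      have := (EuclideanSpace.basisFun (Fin s) ℝ).toBasis.span_eq
      rw [OrthonormalBasis.coe_toBasis] at this
      rw [this]
      rfl
    exact (isOpen_interior.measure_pos volume hne).trans_le (measure_mono interior_subset)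
  · exact (((Set.finite_range _).insert 0).isCompact_convexHull ℝ).measure_lt_top.ne

/-- The volume of a simplex is proportional to the square root of the Gram determinant of the
edges from a vertex. -/
theorem euclideanHausdorffMeasure_real_convexHull {s : ℕ} (q : Fin s → EuclideanSpace ℝ (Fin D))
    (z : EuclideanSpace ℝ (Fin D)) :
    (μHE[s] : Measure (EuclideanSpace ℝ (Fin D))).real
        (convexHull ℝ (insert z (Set.range fun j => q j))) =
      volume.real (cornerSimplex s) * Real.sqrt (Matrix.gram ℝ fun j => q j - z).det := by
  set f : EuclideanSpace ℝ (Fin s) →ₗ[ℝ] EuclideanSpace ℝ (Fin D) :=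
    (EuclideanSpace.basisFun (Fin s) ℝ).toBasis.constr ℝ (fun j => q j - z) with hf
  have hfb : ∀ j, f (EuclideanSpace.basisFun (Fin s) ℝ j) = q j - z := by
    intro j
    rw [hf, ← OrthonormalBasis.coe_toBasis, Module.Basis.constr_basis]
  have himg : convexHull ℝ (insert z (Set.range fun j => q j)) =
      IsometryEquiv.addLeft z '' (f '' cornerSimplex s) := by
    rw [cornerSimplex, f.image_convexHull, Set.image_insert_eq, map_zero, ← Set.range_comp]
    have h1 : (IsometryEquiv.addLeft z : EuclideanSpace ℝ (Fin D) → _) = fun y => z +ᵥ y := rfl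
    rw [h1, Set.image_vadd, ← convexHull_vadd, ← Set.image_vadd, Set.image_insert_eq,
      ← Set.range_comp]
    simp only [Function.comp_def, hfb, vadd_eq_add, add_zero, add_sub_cancel]
  have hvol := f.euclideanHausdorffMeasure_image_eq_normDet_mul_volume (cornerSimplex s)
  rw [finrank_euclideanSpace_fin] at hvol
  have hdet : Real.sqrt (Matrix.gram ℝ fun j => q j - z).det = f.normDet := by
    have h1 := f.normDet_sq_eq_det_gram (EuclideanSpace.basisFun (Fin s) ℝ)
    simp only [hfb, RCLike.ofReal_real_eq_id, id] at h1
    rw [← h1, Real.sqrt_sq f.normDet_nonneg]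
  rw [himg, measureReal_def, (IsometryEquiv.addLeft z).isometry.euclideanHausdorffMeasure_image,
    hvol, ENNReal.toReal_mul, ENNReal.toReal_ofReal f.normDet_nonneg, hdet, mul_comm]
  rfl

/-- The volume of the simplex of local projections. -/
theorem euclideanHausdorffMeasure_real_projectionSimplex (M : Set (EuclideanSpace ℝ (Fin D)))
    (δ : ℝ) {s : ℕ} (x : Fin s → EuclideanSpace ℝ (Fin D)) (z : EuclideanSpace ℝ (Fin D)) :
    (μHE[s] : Measure (EuclideanSpace ℝ (Fin D))).real (projectionSimplex M δ x z) =
      volume.real (cornerSimplex s) *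
        Real.sqrt (Matrix.gram ℝ fun j => localProjection M (x j) δ z - z).det :=
  euclideanHausdorffMeasure_real_convexHull _ z

/-! ### Linear growth of the volume and transversal non-degeneracy -/

namespace LocalProjectionsWellDefined

variable {M : Set (EuclideanSpace ℝ (Fin D))} {z₀ : EuclideanSpace ℝ (Fin D)} {δ' δ : ℝ}

theorem localProjection_self (h : LocalProjectionsWellDefined M z₀ δ' δ) (hδ' : 0 < δ')
    {x : EuclideanSpace ℝ (Fin D)} (hx : x ∈ projections M z₀) :
    localProjection M x δ z₀ = x := by
  have hδ : 0 < δ := nonempty_ball.1 ⟨_, h.mem_ball x hx z₀ (mem_ball_self hδ')⟩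
  exact (eq_localProjection (h.existsUnique x hx z₀ (mem_ball_self hδ'))
    (mem_projections_inter hx (mem_closedBall_self hδ.le))).symm

theorem contDiffAt (h : LocalProjectionsWellDefined M z₀ δ' δ) (hδ' : 0 < δ')
    {x : EuclideanSpace ℝ (Fin D)} (hx : x ∈ projections M z₀) :
    ContDiffAt ℝ 1 (localProjection M x δ) z₀ :=
  (h.contDiffOn x hx).contDiffAt (ball_mem_nhds z₀ hδ')

theorem differentiableAt (h : LocalProjectionsWellDefined M z₀ δ' δ) (hδ' : 0 < δ')
    {x : EuclideanSpace ℝ (Fin D)} (hx : x ∈ projections M z₀) :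
    DifferentiableAt ℝ (localProjection M x δ) z₀ :=
  (h.contDiffAt hδ' hx).differentiableAt (by norm_num)

end LocalProjectionsWellDefined

theorem EnumeratesProjections.mem {M : Set (EuclideanSpace ℝ (Fin D))} {s : ℕ}
    {x : Fin s → EuclideanSpace ℝ (Fin D)} {z₀ : EuclideanSpace ℝ (Fin D)}
    (hx : EnumeratesProjections M z₀ x) (i : Fin s) : x i ∈ projections M z₀ :=
  hx.2.le (Set.mem_range_self i)

variable {M : Set (EuclideanSpace ℝ (Fin D))} {z₀ : EuclideanSpace ℝ (Fin D)} {δ' δ : ℝ} {s : ℕ}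
  {x : Fin s → EuclideanSpace ℝ (Fin D)} {lam : Fin s → ℝ}

/-- Rescaled Gram determinants of the simplices of local projections converge to the Gram
determinant which detects transversal non-degeneracy. -/
theorem LocalProjectionsWellDefined.tendsto_det_gram
    (hwd : LocalProjectionsWellDefined M z₀ δ' δ) (hδ' : 0 < δ') (hx : EnumeratesProjections M z₀ x)
    (hbar : IsInteriorBarycenter x lam z₀) (i₀ : Fin s) {α : Type*} {l : Filter α}
    {d : α → EuclideanSpace ℝ (Fin D)} {c : α → ℝ} {v : EuclideanSpace ℝ (Fin D)}
    (hd : Tendsto d l (𝓝 0)) (hcd : Tendsto (fun n => c n • d n) l (𝓝 v)) :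
    Tendsto (fun n => c n ^ 2 * (lam i₀ ^ 2 *
        (Matrix.gram ℝ fun j => localProjection M (x j) δ (z₀ + d n) - (z₀ + d n)).det)) l
      (𝓝 (Matrix.gram ℝ (Function.update (fun k => x k - z₀) i₀
        (meanDisplacement M δ x lam z₀ v))).det) := by
  -- The prefactor is absorbed by replacing column `i₀` with the combination of coefficients `c n *
  -- lam j`. That combination vanishes at `z₀` before scaling, so it is a difference quotient
  -- converging to the mean displacement of `v`; the other columns tend to `x j - z₀`.
  have hq : ∀ n, c n ^ 2 * (lam i₀ ^ 2 *
        (Matrix.gram ℝ fun j => localProjection M (x j) δ (z₀ + d n) - (z₀ + d n)).det) =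
      (Matrix.gram ℝ (Function.update
        (fun j => localProjection M (x j) δ (z₀ + d n) - (z₀ + d n)) i₀
        (c n • ∑ j, lam j • (localProjection M (x j) δ (z₀ + d n) - (z₀ + d n))))).det := by
    intro n
    have h1 := det_gram_update_sum_smul
      (fun j => localProjection M (x j) δ (z₀ + d n) - (z₀ + d n)) (fun j => c n * lam j) i₀
    simp only [mul_smul, ← Finset.smul_sum] at h1
    rw [h1]
    ring
  simp_rw [hq]
  have hz : Tendsto (fun n => z₀ + d n) l (𝓝 z₀) := by simpa using hd.const_add z₀
  have hcols : Tendsto (fun n j => localProjection M (x j) δ (z₀ + d n) - (z₀ + d n)) l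
      (𝓝 fun j => x j - z₀) := by
    rw [tendsto_pi_nhds]
    intro j
    have h1 := (hwd.contDiffAt hδ' (hx.mem j)).continuousAt.tendsto.comp hz
    rw [hwd.localProjection_self hδ' (hx.mem j)] at h1
    exact h1.sub hz
  have hF : HasFDerivAt (fun z => ∑ j, lam j • (localProjection M (x j) δ z - z))
      (meanDisplacement M δ x lam z₀) z₀ := by
    refine HasFDerivAt.fun_sum fun j _ => HasFDerivAt.fun_const_smul ?_ _
    exact (hwd.differentiableAt hδ' (hx.mem j)).hasFDerivAt.sub (hasFDerivAt_id z₀)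
  have hcol : Tendsto (fun n =>
      c n • ∑ j, lam j • (localProjection M (x j) δ (z₀ + d n) - (z₀ + d n))) l
      (𝓝 (meanDisplacement M δ x lam z₀ v)) := by
    have h1 := hF.hasFDerivWithinAt.lim (s := Set.univ) hd (by simp) hcd
    have h0 : ∑ j, lam j • (localProjection M (x j) δ z₀ - z₀) = 0 := by
      rw [← hbar.sum_smul_sub]
      refine Finset.sum_congr rfl fun j _ => ?_
      rw [hwd.localProjection_self hδ' (hx.mem j)]
    simpa only [h0, sub_zero] using h1
  have hcont : Continuous fun q : Fin s → EuclideanSpace ℝ (Fin D) => (Matrix.gram ℝ q).det := by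
    refine Continuous.matrix_det ?_
    refine continuous_matrix fun i j => ?_
    simp only [Matrix.gram_apply]
    fun_prop
  exact (hcont.tendsto _).comp (hcols.update i₀ hcol)

/-- Close to a critical point, the volume of the simplices of local projections grows linearly in
transversal directions if and only if the critical point is transversally non-degenerate. -/
theorem LocalProjectionsWellDefined.exists_le_volume_iff
    (hwd : LocalProjectionsWellDefined M z₀ δ' δ) (hδ' : 0 < δ') (hx : EnumeratesProjections M z₀ x)
    (hbar : IsInteriorBarycenter x lam z₀) :
    (∃ r > (0 : ℝ), ∃ L > (0 : ℝ), ∀ h ∈ orthDirections M z₀, ‖h‖ < r → L * ‖h‖ ≤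
        (μHE[s] : Measure (EuclideanSpace ℝ (Fin D))).real (projectionSimplex M δ x (z₀ + h))) ↔
      IsTransversallyNondegenerate M δ x lam z₀ := by
  obtain ⟨i₀⟩ := hbar.nonempty
  have hlam := hbar.pos i₀
  have hκ := volume_real_cornerSimplex_pos s
  set κ := (volume : Measure (EuclideanSpace ℝ (Fin s))).real (cornerSimplex s) with hκdef
  simp only [euclideanHausdorffMeasure_real_projectionSimplex, ← hκdef, hx.orthDirections_eq]
  have hgram : ∀ h, 0 ≤
      (Matrix.gram ℝ fun j => localProjection M (x j) δ (z₀ + h) - (z₀ + h)).det := fun h =>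
    (Matrix.posSemidef_gram ℝ _).det_nonneg
  constructor
  · rintro ⟨r, hr, L, hL, hbound⟩ h hh hmem
    by_contra hne
    have hnorm : 0 < ‖h‖ := norm_pos_iff.2 hne
    have hd : Tendsto (fun n : ℕ => ((n : ℝ) + 1)⁻¹ • h) atTop (𝓝 0) := by
      have := tendsto_one_div_add_atTop_nhds_zero_nat (𝕜 := ℝ)
      simpa using this.smul_const h
    have hcd : Tendsto (fun n : ℕ => ((n : ℝ) + 1) • ((n : ℝ) + 1)⁻¹ • h) atTop (𝓝 h) := by
      refine tendsto_const_nhds.congr fun n => ?_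
      rw [smul_inv_smul₀ (by positivity)]
    have hlim := hwd.tendsto_det_gram hδ' hx hbar i₀ hd hcd
    rw [(hbar.det_gram_update_eq_zero_iff i₀ _).2 hmem] at hlim
    -- The volume bound along `h / (n + 1)` keeps the rescaled determinants above a positive
    -- constant, whereas their limit is zero.
    have hge : ∀ᶠ n : ℕ in atTop, lam i₀ ^ 2 * (L * ‖h‖ / κ) ^ 2 ≤ ((n : ℝ) + 1) ^ 2 *
        (lam i₀ ^ 2 * (Matrix.gram ℝ fun j => localProjection M (x j) δ
          (z₀ + ((n : ℝ) + 1)⁻¹ • h) - (z₀ + ((n : ℝ) + 1)⁻¹ • h)).det) := by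
      have hsmall : ∀ᶠ n : ℕ in atTop, ‖((n : ℝ) + 1)⁻¹ • h‖ < r := by
        have := hd.norm
        rw [norm_zero] at this
        exact this.eventually_lt_const hr
      filter_upwards [hsmall] with n hn
      have h1 := hbound _ (Submodule.smul_mem _ _ hh) hn
      set g := (Matrix.gram ℝ fun j => localProjection M (x j) δ
          (z₀ + ((n : ℝ) + 1)⁻¹ • h) - (z₀ + ((n : ℝ) + 1)⁻¹ • h)).det with hg
      have hg0 : 0 ≤ g := hgram _
      have hn0 : (0 : ℝ) < (n : ℝ) + 1 := by positivity
      rw [norm_smul, norm_inv, Real.norm_of_nonneg hn0.le] at h1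
      have h2 : L * ‖h‖ / κ ≤ ((n : ℝ) + 1) * Real.sqrt g := by
        rw [div_le_iff₀ hκ]
        have h3 := mul_le_mul_of_nonneg_left h1 hn0.le
        have h4 : ((n : ℝ) + 1) * (L * (((n : ℝ) + 1)⁻¹ * ‖h‖)) = L * ‖h‖ := by field_simp
        rw [h4] at h3
        linarith
      have h5 := pow_le_pow_left₀ (by positivity) h2 2
      rw [mul_pow, Real.sq_sqrt hg0] at h5
      nlinarith [mul_le_mul_of_nonneg_left h5 (sq_nonneg (lam i₀))]
    have := ge_of_tendsto hlim hge
    have hpos : 0 < lam i₀ ^ 2 * (L * ‖h‖ / κ) ^ 2 := by positivity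
    linarith
  · intro hN
    by_contra hcon
    push Not at hcon
    choose h hh hsmall hvol using fun n : ℕ =>
      hcon (1 / ((n : ℝ) + 1)) (by positivity) (1 / ((n : ℝ) + 1)) (by positivity)
    have hpos : ∀ n, 0 < ‖h n‖ := by
      intro n
      by_contra h0
      have h1 : ‖h n‖ = 0 := le_antisymm (not_lt.1 h0) (norm_nonneg _)
      have h2 := hvol n
      rw [h1, mul_zero] at h2
      exact absurd h2 (not_lt.2 (by positivity))
    have hunit : ∀ n, ‖h n‖⁻¹ • h n ∈ sphere (0 : EuclideanSpace ℝ (Fin D)) 1 := by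
      intro n
      rw [mem_sphere_zero_iff_norm, norm_smul, norm_inv, norm_norm, inv_mul_cancel₀ (hpos n).ne']
    -- Along this subsequence the rescaled determinants tend both to the Gram determinant in the
    -- unit direction `v` and to zero.
    obtain ⟨v, hv, φ, hφ, hlimv⟩ := (isCompact_sphere _ _).tendsto_subseq hunit
    have hone := tendsto_one_div_add_atTop_nhds_zero_nat (𝕜 := ℝ)
    have hd : Tendsto (fun n => h (φ n)) atTop (𝓝 0) := by
      rw [tendsto_zero_iff_norm_tendsto_zero]
      exact (squeeze_zero (fun n => norm_nonneg _) (fun n => (hsmall n).le) hone).comp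
        hφ.tendsto_atTop
    have hlim := hwd.tendsto_det_gram hδ' hx hbar i₀ hd (c := fun n => ‖h (φ n)‖⁻¹) hlimv
    have hzero : Tendsto (fun n => ‖h (φ n)‖⁻¹ ^ 2 * (lam i₀ ^ 2 * (Matrix.gram ℝ fun j =>
        localProjection M (x j) δ (z₀ + h (φ n)) - (z₀ + h (φ n))).det)) atTop (𝓝 0) := by
      have hb : Tendsto (fun n : ℕ => lam i₀ ^ 2 * (1 / ((n : ℝ) + 1) / κ) ^ 2) atTop (𝓝 0) := by
        simpa using ((hone.div_const κ).pow 2).const_mul (lam i₀ ^ 2)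
      refine squeeze_zero (fun n => ?_) (fun n => ?_) (hb.comp hφ.tendsto_atTop)
      · have := hgram (h (φ n))
        positivity
      · have h1 := hvol (φ n)
        have hp := hpos (φ n)
        have hg0 := hgram (h (φ n))
        set g := (Matrix.gram ℝ fun j =>
          localProjection M (x j) δ (z₀ + h (φ n)) - (z₀ + h (φ n))).det with hg
        have h2 : ‖h (φ n)‖⁻¹ * Real.sqrt g ≤ 1 / ((φ n : ℝ) + 1) / κ := by
          rw [le_div_iff₀ hκ, mul_assoc, inv_mul_le_iff₀ hp]
          linarith
        have h3 := pow_le_pow_left₀ (by positivity) h2 2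
        rw [mul_pow, Real.sq_sqrt hg0] at h3
        simp only [Function.comp_apply]
        nlinarith [mul_le_mul_of_nonneg_left h3 (sq_nonneg (lam i₀))]
    have hmem := (hbar.det_gram_update_eq_zero_iff i₀ _).1 (tendsto_nhds_unique hlim hzero)
    have hvE : v ∈ (vectorSpan ℝ (Set.range x))ᗮ :=
      (Submodule.isClosed_orthogonal _).mem_of_tendsto hlimv
        (Eventually.of_forall fun n => Submodule.smul_mem _ _ (hh (φ n)))
    have hv0 := hN v hvE hmem
    rw [hv0] at hv
    simp at hv

/-! ### Non-degeneracy bounds the gradient from below -/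

namespace LocalProjectionsWellDefined

theorem localProjection_mem (hwd : LocalProjectionsWellDefined M z₀ δ' δ)
    {y z : EuclideanSpace ℝ (Fin D)} (hy : y ∈ projections M z₀) (hz : z ∈ ball z₀ δ') :
    localProjection M y δ z ∈ M :=
  (localProjection_mem_projections (hwd.existsUnique y hy z hz)).1.1

/-- The derivative of the local projection is orthogonal to `z₀ - y`, so to first order the foot
point may be considered fixed at `y`. Strict differentiability is what the implicit function theorem
needs later. -/
theorem hasStrictFDerivAt_norm_sub_sq (hwd : LocalProjectionsWellDefined M z₀ δ' δ)
    (hδ' : 0 < δ') {y : EuclideanSpace ℝ (Fin D)} (hy : y ∈ projections M z₀) :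
    HasStrictFDerivAt (fun z => ‖z - localProjection M y δ z‖ ^ 2)
      (2 • innerSL ℝ (z₀ - y)) z₀ := by
  have hp := (hwd.contDiffAt hδ' hy).hasStrictFDerivAt (by norm_num)
  have hself := hwd.localProjection_self hδ' hy
  have h1 := (hasStrictFDerivAt_norm_sq _).comp z₀ ((hasStrictFDerivAt_id z₀).sub hp)
  refine h1.congr_fderiv ?_
  ext v
  have h2 := inner_fderiv_eq_zero_of_dist_le (z := z₀) (hwd.differentiableAt hδ' hy) (by
    filter_upwards [ball_mem_nhds z₀ hδ'] with w hw
    rw [hself, hy.2]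
    exact infDist_le_dist_of_mem (hwd.localProjection_mem hy hw)) v
  rw [hself] at h2
  have h3 : ⟪z₀ - y, fderiv ℝ (localProjection M y δ) z₀ v⟫ = 0 := by
    rw [← neg_sub, inner_neg_left, h2, neg_zero]
  rw [inner_sub_left] at h3
  simp [hself, h3]

theorem norm_sub_localProjection_sq (hwd : LocalProjectionsWellDefined M z₀ δ' δ)
    (hδ' : 0 < δ') {y : EuclideanSpace ℝ (Fin D)} (hy : y ∈ projections M z₀) :
    ‖z₀ - localProjection M y δ z₀‖ ^ 2 = infDist z₀ M ^ 2 := by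
  rw [hwd.localProjection_self hδ' hy, ← dist_eq_norm, hy.2]

end LocalProjectionsWellDefined

theorem IsInteriorBarycenter.sub_mem_vectorSpan (h : IsInteriorBarycenter x lam z₀) (i : Fin s) :
    x i - z₀ ∈ vectorSpan ℝ (Set.range x) := by
  rw [mem_vectorSpan_range_iff i]
  refine ⟨fun k => Pi.single (M := fun _ => ℝ) i 1 k - lam k, ?_, ?_⟩
  · rw [Finset.sum_sub_distrib, h.sum_eq_one]; simp
  · simp only [sub_smul, Finset.sum_sub_distrib]
    rw [h.sum_smul]
    simp [Pi.single_apply, ite_smul]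

theorem mem_vectorSpan_range_orthogonal_of_inner_eq {v : EuclideanSpace ℝ (Fin D)}
    (h : ∀ i j, ⟪x i, v⟫ = ⟪x j, v⟫) : v ∈ (vectorSpan ℝ (Set.range x))ᗮ := by
  rw [Submodule.mem_orthogonal]
  intro u hu
  rcases isEmpty_or_nonempty (Fin s) with he | ⟨⟨i₀⟩⟩
  · have : Set.range x = ∅ := Set.range_eq_empty x
    rw [this, vectorSpan_empty, Submodule.mem_bot] at hu
    rw [hu, inner_zero_left]
  · obtain ⟨d, hd, rfl⟩ := (mem_vectorSpan_range_iff i₀).1 hu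
    simp only [sum_inner, real_inner_smul_left]
    simp only [h _ i₀]
    rw [← Finset.sum_mul, hd, zero_mul]

theorem tendsto_smul_sub_of_hasFDerivAt {F : Type*} [NormedAddCommGroup F] [NormedSpace ℝ F]
    {f : EuclideanSpace ℝ (Fin D) → F} {f' : EuclideanSpace ℝ (Fin D) →L[ℝ] F}
    (hf : HasFDerivAt f f' z₀) {α : Type*} {l : Filter α} {z : α → EuclideanSpace ℝ (Fin D)}
    {c : α → ℝ} {v : EuclideanSpace ℝ (Fin D)} (hz : Tendsto z l (𝓝 z₀))
    (hc : Tendsto (fun n => c n • (z n - z₀)) l (𝓝 v)) :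
    Tendsto (fun n => c n • (f (z n) - f z₀)) l (𝓝 (f' v)) := by
  have h1 := hf.hasFDerivWithinAt.lim (s := Set.univ) (d := fun n => z n - z₀)
    (by simpa using hz.sub_const z₀) (by simp) hc
  simpa using h1

/-- Close to a transversally non-degenerate critical point, the gradient of the distance function
grows at least linearly. -/
theorem LocalProjectionsWellDefined.exists_mul_dist_le_norm_distGradient
    (hwd : LocalProjectionsWellDefined M z₀ δ' δ) (hδ' : 0 < δ') (hcpt : IsCompact M)
    (hne : M.Nonempty) (hx : EnumeratesProjections M z₀ x) (hbar : IsInteriorBarycenter x lam z₀)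
    (hN : IsTransversallyNondegenerate M δ x lam z₀) :
    ∃ c > (0 : ℝ), ∀ᶠ z in 𝓝 z₀, z ∉ M → c * dist z z₀ ≤ ‖distGradient M z‖ := by
  by_contra hcon
  push Not at hcon
  have hex : ∀ n : ℕ, ∃ z, z ∈ ball z₀ δ' ∧ dist z z₀ < 1 / ((n : ℝ) + 1) ∧ z ∉ M ∧
      ‖distGradient M z‖ < 1 / ((n : ℝ) + 1) * dist z z₀ := by
    intro n
    have hn : (0 : ℝ) < 1 / ((n : ℝ) + 1) := by positivity
    obtain ⟨z, ⟨hz1, hz2⟩, hz3, hz4⟩ := ((hcon _ hn).and_eventually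
      (inter_mem (ball_mem_nhds z₀ hδ') (ball_mem_nhds z₀ hn) :
        ∀ᶠ z in 𝓝 z₀, z ∈ ball z₀ δ' ∩ ball z₀ (1 / ((n : ℝ) + 1)))).exists
    exact ⟨z, hz3, hz4, hz1, hz2⟩
  choose z hzball hzdist hzM hzgrad using hex
  have hpos : ∀ n, 0 < ‖z n - z₀‖ := by
    intro n
    rw [← dist_eq_norm]
    by_contra h0
    have h1 : dist (z n) z₀ = 0 := le_antisymm (not_lt.1 h0) dist_nonneg
    have h2 := hzgrad n
    rw [h1, mul_zero] at h2
    exact absurd h2 (not_lt.2 (norm_nonneg _))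
  -- the nearest points of the hulls as combinations of the local projections
  have hcomb : ∀ n, ∃ w : Fin s → ℝ, w ∈ stdSimplex ℝ (Fin s) ∧
      (∀ i, w i ≠ 0 → localProjection M (x i) δ (z n) ∈ projections M (z n)) ∧
      ‖∑ i, w i • localProjection M (x i) δ (z n) - z n‖ =
        ‖distGradient M (z n)‖ * infDist (z n) M := by
    intro n
    obtain ⟨c, hc, hcd⟩ := exists_dist_eq_norm_distGradient_mul hcpt hne (hzM n)
    have hsub : projections M (z n) ⊆ Set.range fun i => localProjection M (x i) δ (z n) := by
      have h1 := hwd.projections_subset (z n) (hzball n)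
      rw [← hx.2, ← Set.range_comp] at h1
      exact h1
    have hfin : (projections M (z n)).Finite := (Set.finite_range _).subset hsub
    rw [closedConvexHull_eq_closure_convexHull, (hfin.isClosed_convexHull ℝ).closure_eq] at hc
    obtain ⟨w, hw0, hw1, hwc, hw⟩ := exists_weights_of_mem_convexHull hsub hc
    refine ⟨w, ⟨hw0, hw1⟩, hw, ?_⟩
    rw [hwc, ← hcd, dist_comm, dist_eq_norm]
  choose w hwsimp hwproj hwdist using hcomb
  have hmem : ∀ n, (‖z n - z₀‖⁻¹ • (z n - z₀), w n) ∈
      sphere (0 : EuclideanSpace ℝ (Fin D)) 1 ×ˢ stdSimplex ℝ (Fin s) := by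
    intro n
    refine ⟨?_, hwsimp n⟩
    simp only [mem_sphere_zero_iff_norm]
    rw [norm_smul, norm_inv, norm_norm, inv_mul_cancel₀ (hpos n).ne']
  obtain ⟨⟨v, μ⟩, ⟨hv, hμ⟩, φ, hφ, hlim⟩ :=
    ((isCompact_sphere _ _).prod (isCompact_stdSimplex ℝ (Fin s))).tendsto_subseq hmem
  have hlimv : Tendsto (fun n => ‖z (φ n) - z₀‖⁻¹ • (z (φ n) - z₀)) atTop (𝓝 v) :=
    (continuous_fst.tendsto _).comp hlim
  have hlimw : ∀ i, Tendsto (fun n => w (φ n) i) atTop (𝓝 (μ i)) := fun i =>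
    ((continuous_apply i).tendsto _).comp ((continuous_snd.tendsto _).comp hlim)
  have hone := (tendsto_one_div_add_atTop_nhds_zero_nat (𝕜 := ℝ)).comp hφ.tendsto_atTop
  have hz : Tendsto (fun n => z (φ n)) atTop (𝓝 z₀) := by
    rw [tendsto_iff_dist_tendsto_zero]
    exact squeeze_zero (fun _ => dist_nonneg) (fun n => (hzdist (φ n)).le) hone
  have hself : ∀ i, localProjection M (x i) δ z₀ = x i := fun i =>
    hwd.localProjection_self hδ' (hx.mem i)
  have hp : ∀ i, Tendsto (fun n => localProjection M (x i) δ (z (φ n))) atTop (𝓝 (x i)) := by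
    intro i
    have h1 := (hwd.contDiffAt hδ' (hx.mem i)).continuousAt.tendsto.comp hz
    rwa [hself] at h1
  have hquot : Tendsto (fun n => ‖z (φ n) - z₀‖⁻¹ •
      (∑ i, w (φ n) i • localProjection M (x i) δ (z (φ n)) - z (φ n))) atTop (𝓝 0) := by
    rw [tendsto_zero_iff_norm_tendsto_zero]
    have hinf : Tendsto (fun n => 1 / ((φ n : ℝ) + 1) * infDist (z (φ n)) M) atTop (𝓝 0) := by
      simpa using hone.mul (((continuous_infDist_pt M).tendsto z₀).comp hz)
    refine squeeze_zero (fun _ => norm_nonneg _) (fun n => ?_) hinf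
    have hp0 := hpos (φ n)
    rw [norm_smul, norm_inv, norm_norm, hwdist, inv_mul_le_iff₀ hp0]
    have h1 := (hzgrad (φ n)).le
    rw [dist_eq_norm] at h1
    calc _ ≤ (1 / ((φ n : ℝ) + 1) * ‖z (φ n) - z₀‖) * infDist (z (φ n)) M :=
          mul_le_mul_of_nonneg_right h1 infDist_nonneg
      _ = _ := by ring
  have hnorm0 : Tendsto (fun n => ‖z (φ n) - z₀‖) atTop (𝓝 0) := by
    simpa using (hz.sub_const z₀).norm
  -- The nearest points of the hulls converge to `z₀`, so the limit weights are barycentric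
  -- coordinates of `z₀`, and these are unique.
  have hμlam : μ = lam := by
    refine eq_of_sum_smul_eq hbar.affineIndependent (by rw [hbar.sum_eq_one]; exact hμ.2) ?_
    rw [hbar.sum_smul]
    have h1 : Tendsto (fun n => ∑ i, w (φ n) i • localProjection M (x i) δ (z (φ n)) - z (φ n))
        atTop (𝓝 (∑ i, μ i • x i - z₀)) :=
      (tendsto_finsetSum _ fun i _ => (hlimw i).smul (hp i)).sub hz
    have h2 := hnorm0.smul hquot
    rw [smul_zero] at h2
    have h3 := h2.congr fun n => smul_inv_smul₀ (hpos (φ n)).ne' _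
    exact sub_eq_zero.1 (tendsto_nhds_unique h1 h3)
  have hall : ∀ᶠ n in atTop, ∀ i, localProjection M (x i) δ (z (φ n)) ∈
      projections M (z (φ n)) := by
    rw [eventually_all]
    intro i
    have h1 := (hlimw i).eventually_ne (b₂ := 0) (by rw [hμlam]; exact (hbar.pos i).ne')
    filter_upwards [h1] with n hn using hwproj _ i hn
  -- The squared distances to the local projections agree along the sequence and at `z₀`, so their
  -- derivatives `2⟪z₀ - x k, v⟫` agree too.
  have hvE : v ∈ (vectorSpan ℝ (Set.range x))ᗮ := by
    refine mem_vectorSpan_range_orthogonal_of_inner_eq fun i j => ?_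
    have h1 := fun k => tendsto_smul_sub_of_hasFDerivAt
      (hwd.hasStrictFDerivAt_norm_sub_sq hδ' (hx.mem k)).hasFDerivAt hz hlimv
    have h2 := tendsto_nhds_unique_of_eventuallyEq (h1 i) (h1 j) (by
      filter_upwards [hall] with n hn
      have h3 : ∀ k, ‖z (φ n) - localProjection M (x k) δ (z (φ n))‖ = infDist (z (φ n)) M :=
        fun k => by rw [← dist_eq_norm, (hn k).2]
      rw [hwd.norm_sub_localProjection_sq hδ' (hx.mem i),
        hwd.norm_sub_localProjection_sq hδ' (hx.mem j), h3 i, h3 j])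
    simp only [smul_apply, innerSL_apply_apply, inner_sub_left, nsmul_eq_mul] at h2
    push_cast at h2
    linarith
  have hmemE : meanDisplacement M δ x lam z₀ v ∈ vectorSpan ℝ (Set.range x) := by
    rw [meanDisplacement_apply]
    have h1 : ∀ i, Tendsto (fun n => ‖z (φ n) - z₀‖⁻¹ •
        (localProjection M (x i) δ (z (φ n)) - x i)) atTop
        (𝓝 (fderiv ℝ (localProjection M (x i) δ) z₀ v)) := by
      intro i
      have := tendsto_smul_sub_of_hasFDerivAt
        (hwd.differentiableAt hδ' (hx.mem i)).hasFDerivAt hz hlimv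
      rwa [hself] at this
    have h2 : Tendsto (fun n => ∑ i, w (φ n) i • (‖z (φ n) - z₀‖⁻¹ •
        (localProjection M (x i) δ (z (φ n)) - x i) - ‖z (φ n) - z₀‖⁻¹ • (z (φ n) - z₀))) atTop
        (𝓝 (∑ i, lam i • (fderiv ℝ (localProjection M (x i) δ) z₀ v - v))) :=
      tendsto_finsetSum _ fun i _ => (hμlam ▸ hlimw i).smul ((h1 i).sub hlimv)
    have h3 := h2.sub hquot
    rw [sub_zero] at h3
    have hclosed : IsClosed (vectorSpan ℝ (Set.range x) : Set (EuclideanSpace ℝ (Fin D))) :=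
      Submodule.closed_of_finiteDimensional _
    refine hclosed.mem_of_tendsto h3 (Eventually.of_forall fun n => ?_)
    -- The quotient tending to zero differs from the approximate mean displacement only by a
    -- combination of the `x i - z₀`, which lies in the closed subspace `E`.
    have h4 : ∑ i, w (φ n) i • (‖z (φ n) - z₀‖⁻¹ •
        (localProjection M (x i) δ (z (φ n)) - x i) - ‖z (φ n) - z₀‖⁻¹ • (z (φ n) - z₀)) -
        ‖z (φ n) - z₀‖⁻¹ • (∑ i, w (φ n) i • localProjection M (x i) δ (z (φ n)) - z (φ n)) =
        -(‖z (φ n) - z₀‖⁻¹ • ∑ i, w (φ n) i • (x i - z₀)) := by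
      have h5 : ∀ y, y = ∑ i, w (φ n) i • y := fun y : EuclideanSpace ℝ (Fin D) => by
        rw [← Finset.sum_smul, (hwsimp (φ n)).2, one_smul]
      conv_lhs =>
        enter [2, 2, 2]
        rw [h5 (z (φ n))]
      rw [← Finset.sum_sub_distrib, Finset.smul_sum, ← Finset.sum_sub_distrib, Finset.smul_sum,
        ← Finset.sum_neg_distrib]
      refine Finset.sum_congr rfl fun i _ => ?_
      module
    rw [h4]
    exact Submodule.neg_mem _ (Submodule.smul_mem _ _ (Submodule.sum_mem _ fun i _ =>
      Submodule.smul_mem _ _ (hbar.sub_mem_vectorSpan i)))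
  have hv0 := hN v hvE hmemE
  rw [hv0] at hv
  simp at hv

/-! ### (P4) forces non-degeneracy -/

theorem surjective_inner_of_linearIndependent {ι : Type*} [Fintype ι]
    {a : ι → EuclideanSpace ℝ (Fin D)} (ha : LinearIndependent ℝ a) (b : ι → ℝ) :
    ∃ v, ∀ i, ⟪a i, v⟫ = b i := by
  classical
  have hunit : IsUnit (Matrix.gram ℝ a) := by
    rw [Matrix.isUnit_iff_isUnit_det, isUnit_iff_ne_zero]
    exact Matrix.det_gram_ne_zero_iff_linearIndependent.2 ha
  obtain ⟨c, hc⟩ := Matrix.mulVec_surjective_iff_isUnit.2 hunit b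
  refine ⟨∑ k, c k • a k, fun i => ?_⟩
  rw [← hc]
  simp [inner_sum, real_inner_smul_right, Matrix.mulVec, dotProduct, Matrix.gram_apply, mul_comm]

/-- Every direction orthogonal to the simplex of projections is tangent to a sequence of points
which are equidistant to their local projections. -/
theorem LocalProjectionsWellDefined.exists_tendsto_equidistant
    (hwd : LocalProjectionsWellDefined M z₀ δ' δ) (hδ' : 0 < δ') (hx : EnumeratesProjections M z₀ x)
    (haff : AffineIndependent ℝ x) (i₀ : Fin s) {h : EuclideanSpace ℝ (Fin D)}
    (hh : h ∈ (vectorSpan ℝ (Set.range x))ᗮ) :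
    ∃ z : ℕ → EuclideanSpace ℝ (Fin D), Tendsto z atTop (𝓝 z₀) ∧
      Tendsto (fun n : ℕ => ((n : ℝ) + 1) • (z n - z₀)) atTop (𝓝 h) ∧
      ∀ᶠ n in atTop, ∀ i, dist (z n) (localProjection M (x i) δ (z n)) =
        dist (z n) (localProjection M (x i₀) δ (z n)) := by
  -- The zeros of `F` are the points equidistant from their local projections. Affine independence
  -- makes the derivative surjective once the index `i₀` is dropped, and its kernel contains `E^⊥`.
  set F : EuclideanSpace ℝ (Fin D) → ({i // i ≠ i₀} → ℝ) := fun z i =>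
    ‖z - localProjection M (x i₀) δ z‖ ^ 2 - ‖z - localProjection M (x i) δ z‖ ^ 2 with hF
  set F' : EuclideanSpace ℝ (Fin D) →L[ℝ] ({i // i ≠ i₀} → ℝ) :=
    ContinuousLinearMap.pi fun i => 2 • innerSL ℝ (z₀ - x i₀) - 2 • innerSL ℝ (z₀ - x i) with hF'
  have hstrict : HasStrictFDerivAt F F' z₀ := by
    rw [hasStrictFDerivAt_pi]
    exact fun i => (hwd.hasStrictFDerivAt_norm_sub_sq hδ' (hx.mem i₀)).sub
      (hwd.hasStrictFDerivAt_norm_sub_sq hδ' (hx.mem i))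
  have hF'apply : ∀ v i, F' v i = 2 * ⟪x i - x i₀, v⟫ := by
    intro v i
    simp [hF', inner_sub_left]
    ring
  have hsurj : F'.range = ⊤ := by
    rw [LinearMap.range_eq_top]
    intro b
    obtain ⟨v, hv⟩ := surjective_inner_of_linearIndependent
      ((affineIndependent_iff_linearIndependent_vsub ℝ x i₀).1 haff) (fun i => b i / 2)
    refine ⟨v, ?_⟩
    ext i
    have := hv i
    rw [vsub_eq_sub] at this
    simp only [ContinuousLinearMap.coe_coe]
    rw [hF'apply, this]
    ring
  have hker : h ∈ F'.ker := by
    rw [LinearMap.mem_ker]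
    ext i
    simp only [ContinuousLinearMap.coe_coe]
    rw [hF'apply, ← vsub_eq_sub, Submodule.inner_right_of_mem_orthogonal
      (vsub_mem_vectorSpan ℝ (Set.mem_range_self (i : Fin s)) (Set.mem_range_self i₀)) hh]
    simp
  have hF0 : F z₀ = 0 := by
    ext i
    simp [hF, hwd.norm_sub_localProjection_sq hδ' (hx.mem _)]
  -- `γ` parametrizes the level set by the kernel of `F'`, with the inclusion as derivative at `0`;
  -- so `γ (h / (n + 1))` leaves `z₀` in the direction `h`.
  set γ := hstrict.implicitFunction F F' hsurj (F z₀) with hγ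
  have hγ0 : γ 0 = z₀ := hstrict.implicitFunction_apply_image hsurj
  have hd : Tendsto (fun n : ℕ => ((n : ℝ) + 1)⁻¹ • (⟨h, hker⟩ : F'.ker)) atTop (𝓝 0) := by
    have := tendsto_one_div_add_atTop_nhds_zero_nat (𝕜 := ℝ)
    simpa using this.smul_const (⟨h, hker⟩ : F'.ker)
  refine ⟨fun n => γ (((n : ℝ) + 1)⁻¹ • ⟨h, hker⟩), ?_, ?_, ?_⟩
  · exact hstrict.tendsto_implicitFunction hsurj tendsto_const_nhds hd
  · have h1 := (hstrict.to_implicitFunction hsurj).hasFDerivAt.hasFDerivWithinAt.lim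
      (s := Set.univ) hd (by simp) (c := fun n : ℕ => (n : ℝ) + 1) (v := ⟨h, hker⟩)
      (tendsto_const_nhds.congr fun n => by rw [smul_inv_smul₀ (by positivity)])
    simp only [zero_add] at h1
    rw [← hγ, hγ0] at h1
    exact h1
  · have h1 := (tendsto_const_nhds (x := F z₀)).prodMk_nhds hd |>.eventually
      (hstrict.map_implicitFunction_eq hsurj)
    filter_upwards [h1] with n hn i
    rcases eq_or_ne i i₀ with rfl | hi
    · rfl
    have h2 := congrFun (hn.trans hF0) ⟨i, hi⟩
    simp only [hF, Pi.zero_apply] at h2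
    rw [dist_eq_norm, dist_eq_norm]
    exact ((sq_eq_sq₀ (norm_nonneg _) (norm_nonneg _)).1 (sub_eq_zero.1 h2)).symm

/-- If `μ`-critical points are at distance `O(μ)` from critical points, then every critical point
is transversally non-degenerate. -/
theorem LocalProjectionsWellDefined.isTransversallyNondegenerate_of_propertyP4
    (hwd : LocalProjectionsWellDefined M z₀ δ' δ) (hδ' : 0 < δ') (hcpt : IsCompact M)
    (hne : M.Nonempty) (hz₀ : z₀ ∈ criticalPoints M) (hP2 : PropertyP2 M) (hP4 : PropertyP4 M)
    (hx : EnumeratesProjections M z₀ x) (hbar : IsInteriorBarycenter x lam z₀) :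
    IsTransversallyNondegenerate M δ x lam z₀ := by
  intro h hh hmem
  obtain ⟨i₀⟩ := hbar.nonempty
  obtain ⟨z, hz, hzh, heq⟩ :=
    hwd.exists_tendsto_equidistant hδ' hx hbar.affineIndependent i₀ hh
  obtain ⟨d, hd0, hd⟩ := (mem_vectorSpan_range_iff i₀).1 hmem
  have hzM : ∀ᶠ n in atTop, z n ∉ M :=
    hz.eventually (hcpt.isClosed.isOpen_compl.mem_nhds hz₀.1)
  -- Some local projection is a nearest point of `M`, and by equidistance all of them are.
  have hproj : ∀ᶠ n in atTop, ∀ i, localProjection M (x i) δ (z n) ∈ projections M (z n) := by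
    filter_upwards [hz.eventually (ball_mem_nhds z₀ hδ'), heq] with n hn heqn i
    refine ⟨hwd.localProjection_mem (hx.mem i) hn, ?_⟩
    obtain ⟨y, hy⟩ := projections_nonempty hcpt hne (z n)
    obtain ⟨x', hx', rfl⟩ := hwd.projections_subset (z n) hn hy
    rw [← hx.2] at hx'
    obtain ⟨j, rfl⟩ := hx'
    rw [← hy.2, heqn i]
    exact (heqn j).symm
  have hone := tendsto_one_div_add_atTop_nhds_zero_nat (𝕜 := ℝ)
  -- The correction `d i / (n + 1)` cancels the mean displacement `∑ d i • x i` of `h` at order `1 /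
  -- (n + 1)`. The weights keep total mass one since `∑ d i = 0`, and remain nonnegative since `lam
  -- i > 0`.
  have hweight : ∀ᶠ n : ℕ in atTop, ∀ i, 0 ≤ lam i - 1 / ((n : ℝ) + 1) * d i := by
    rw [eventually_all]
    intro i
    have h1 : Tendsto (fun n : ℕ => lam i - 1 / ((n : ℝ) + 1) * d i) atTop (𝓝 (lam i)) := by
      simpa using (hone.mul_const (d i)).const_sub (lam i)
    filter_upwards [h1.eventually_const_lt (hbar.pos i)] with n hn using hn.le
  have hself : ∀ i, localProjection M (x i) δ z₀ = x i := fun i =>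
    hwd.localProjection_self hδ' (hx.mem i)
  have hconv : Tendsto (fun n : ℕ => ((n : ℝ) + 1) •
      (∑ i, (lam i - 1 / ((n : ℝ) + 1) * d i) • localProjection M (x i) δ (z n) - z n))
      atTop (𝓝 0) := by
    have h1 : ∀ i, Tendsto (fun n : ℕ => ((n : ℝ) + 1) •
        (localProjection M (x i) δ (z n) - x i)) atTop
        (𝓝 (fderiv ℝ (localProjection M (x i) δ) z₀ h)) := by
      intro i
      have := tendsto_smul_sub_of_hasFDerivAt
        (hwd.differentiableAt hδ' (hx.mem i)).hasFDerivAt hz hzh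
      rwa [hself] at this
    have h2 : ∀ i, Tendsto (fun n => localProjection M (x i) δ (z n)) atTop (𝓝 (x i)) := by
      intro i
      have := (hwd.contDiffAt hδ' (hx.mem i)).continuousAt.tendsto.comp hz
      rwa [hself] at this
    have h3 : Tendsto (fun n : ℕ => ∑ i, lam i • (((n : ℝ) + 1) •
        (localProjection M (x i) δ (z n) - x i) - ((n : ℝ) + 1) • (z n - z₀)) -
        ∑ i, d i • localProjection M (x i) δ (z n)) atTop
        (𝓝 (meanDisplacement M δ x lam z₀ h - ∑ i, d i • x i)) := by
      rw [meanDisplacement_apply]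
      exact (tendsto_finsetSum _ fun i _ => ((h1 i).sub hzh).const_smul _).sub
        (tendsto_finsetSum _ fun i _ => (h2 i).const_smul _)
    rw [hd, sub_self] at h3
    refine h3.congr fun n => ?_
    have h5 : ∀ y : EuclideanSpace ℝ (Fin D), y = ∑ i, lam i • y := fun y => by
      rw [← Finset.sum_smul, hbar.sum_eq_one, one_smul]
    have h6 : ((n : ℝ) + 1) * (1 / ((n : ℝ) + 1)) = 1 := by field_simp
    have h7 : ∑ i, (lam i - 1 / ((n : ℝ) + 1) * d i) • localProjection M (x i) δ (z n) - z n =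
        ∑ i, (lam i • (localProjection M (x i) δ (z n) - x i - (z n - z₀)) -
          (1 / ((n : ℝ) + 1) * d i) • localProjection M (x i) δ (z n)) := by
      have h8 : ∑ i, lam i • (localProjection M (x i) δ (z n) - x i - (z n - z₀)) =
          ∑ i, lam i • localProjection M (x i) δ (z n) - z n := by
        have h9 : ∀ i, lam i • (localProjection M (x i) δ (z n) - x i - (z n - z₀)) =
            lam i • localProjection M (x i) δ (z n) - lam i • (x i - z₀) - lam i • z n :=
          fun i => by module
        rw [Finset.sum_congr rfl fun i _ => h9 i, Finset.sum_sub_distrib, Finset.sum_sub_distrib,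
          hbar.sum_smul_sub, sub_zero, ← h5 (z n)]
      rw [Finset.sum_sub_distrib, h8]
      simp only [sub_smul, Finset.sum_sub_distrib]
      abel
    rw [h7, Finset.smul_sum, ← Finset.sum_sub_distrib]
    refine Finset.sum_congr rfl fun i _ => ?_
    have h10 : d i • localProjection M (x i) δ (z n) =
        (((n : ℝ) + 1) * (1 / ((n : ℝ) + 1) * d i)) • localProjection M (x i) δ (z n) := by
      rw [← mul_assoc, h6, one_mul]
    rw [h10]
    module
  have hd₀ := infDist_pos hcpt hne hz₀.1
  have hgrad : Tendsto (fun n : ℕ => ((n : ℝ) + 1) * ‖distGradient M (z n)‖) atTop (𝓝 0) := by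
    have h1 : Tendsto (fun n => infDist (z n) M) atTop (𝓝 (infDist z₀ M)) :=
      ((continuous_infDist_pt M).tendsto z₀).comp hz
    have h2 := hconv.norm.div h1 hd₀.ne'
    rw [norm_zero, zero_div] at h2
    refine squeeze_zero' (Eventually.of_forall fun n => by positivity) ?_ h2
    filter_upwards [hzM, hproj, hweight] with n hnM hnp hnw
    have hmemc : ∑ i, (lam i - 1 / ((n : ℝ) + 1) * d i) • localProjection M (x i) δ (z n) ∈
        closedConvexHull ℝ (projections M (z n)) := by
      refine convex_closedConvexHull.sum_mem (fun i _ => hnw i) ?_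
        (fun i _ => subset_closedConvexHull (hnp i))
      rw [Finset.sum_sub_distrib, ← Finset.mul_sum, hd0, hbar.sum_eq_one, mul_zero, sub_zero]
    have h3 := norm_distGradient_mul_le hcpt hne hnM hmemc
    have hn0 : (0 : ℝ) < (n : ℝ) + 1 := by positivity
    simp only [Pi.div_apply]
    rw [le_div_iff₀ (infDist_pos hcpt hne hnM), norm_smul, Real.norm_of_nonneg hn0.le, mul_assoc]
    rw [dist_comm, dist_eq_norm] at h3
    gcongr
  have hgrad0 : Tendsto (fun n : ℕ => ‖distGradient M (z n)‖) atTop (𝓝 0) := by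
    have h1 := hone.mul hgrad
    rw [zero_mul] at h1
    refine h1.congr fun n => ?_
    field_simp
  obtain ⟨C, hC, μ₀, hμ₀, hthick⟩ := hP4
  -- (P4) only provides some nearby critical point; finiteness of the critical set identifies it
  -- with `z₀`.
  have hisol : ∀ᶠ w in 𝓝 z₀, w ∈ criticalPoints M → w = z₀ := by
    have h1 : IsClosed (criticalPoints M \ {z₀}) := (hP2.subset Set.sdiff_subset).isClosed
    filter_upwards [h1.isOpen_compl.mem_nhds (by simp : z₀ ∈ (criticalPoints M \ {z₀})ᶜ)] with w hw
      hwc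
    by_contra hne'
    exact hw ⟨hwc, hne'⟩
  obtain ⟨ρ, hρ, hball⟩ := Metric.eventually_nhds_iff.1 hisol
  have hnear : ∀ᶠ n in atTop, dist (z n) z₀ ≤ C * ‖distGradient M (z n)‖ := by
    have h1 : Tendsto (fun n => C * ‖distGradient M (z n)‖ + dist (z n) z₀) atTop (𝓝 0) := by
      simpa using (hgrad0.const_mul C).add (tendsto_iff_dist_tendsto_zero.1 hz)
    filter_upwards [hzM, hgrad0.eventually_lt_const hμ₀.1, h1.eventually_lt_const hρ] with
      n hnM hnμ hnρ
    have h2 := hthick _ ⟨norm_nonneg _, hnμ⟩ (⟨hnM, le_rfl⟩ : z n ∈ muCriticalPoints M _)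
    rw [hP2.isCompact.cthickening_eq_biUnion_closedBall (by positivity)] at h2
    obtain ⟨ζ, hζ, hdist⟩ := Set.mem_iUnion₂.1 h2
    rw [mem_closedBall] at hdist
    have h3 : ζ = z₀ := hball (by linarith [dist_triangle ζ (z n) z₀, dist_comm ζ (z n)]) hζ
    rwa [h3] at hdist
  have hfinal : ‖h‖ ≤ C * 0 := by
    refine le_of_tendsto_of_tendsto hzh.norm (hgrad.const_mul C) ?_
    filter_upwards [hnear] with n hn
    have hn0 : (0 : ℝ) < (n : ℝ) + 1 := by positivity
    rw [norm_smul, Real.norm_of_nonneg hn0.le, ← dist_eq_norm]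
    nlinarith
  rw [mul_zero] at hfinal
  exact norm_le_zero_iff.1 hfinal

/-! ### From local bounds to (P4), and conclusion -/

/-- If the gradient of the distance function grows at least linearly around each critical point,
then `μ`-critical points are at distance `O(μ)` from critical points. -/
theorem IsC2Submanifold.propertyP4_of_local {m : ℕ} (hM : IsC2Submanifold m M)
    (hcpt : IsCompact M) (hne : M.Nonempty)
    (hloc : ∀ z₀ ∈ criticalPoints M, ∃ c > (0 : ℝ),
      ∀ᶠ z in 𝓝 z₀, z ∉ M → c * dist z z₀ ≤ ‖distGradient M z‖) : PropertyP4 M := by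
  by_contra hcon
  simp only [PropertyP4, not_exists, not_and, not_forall, Set.not_subset] at hcon
  -- The failure of (P4) is tested with `C = n + 1` and `μ₀ = 1 / (n + 2)`, which is at most `1 / 2`
  -- even for `n = 0`, as the boundedness of the almost critical points requires.
  have hex : ∀ n : ℕ, ∃ μ : ℝ, ∃ z, 0 ≤ μ ∧ μ < 1 / ((n : ℝ) + 1 + 1) ∧
      z ∈ muCriticalPoints M μ ∧ z ∉ cthickening (((n : ℝ) + 1) * μ) (criticalPoints M) := by
    intro n
    obtain ⟨μ, hμ, z, hz1, hz2⟩ := hcon ((n : ℝ) + 1) (by positivity) (1 / ((n : ℝ) + 1 + 1))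
      ⟨by positivity, by
        rw [div_lt_one (by positivity)]
        linarith [(Nat.cast_nonneg n : (0 : ℝ) ≤ n)]⟩
    exact ⟨μ, z, hμ.1, hμ.2, hz1, hz2⟩
  choose μ z hμ0 hμ1 hz hzfar using hex
  have hhalf : ∀ n : ℕ, 1 / ((n : ℝ) + 1 + 1) ≤ 1 / 2 := fun n =>
    one_div_le_one_div_of_le (by norm_num) (by linarith [(Nat.cast_nonneg n : (0 : ℝ) ≤ n)])
  obtain ⟨y, R, hR⟩ := exists_subset_closedBall_of_norm_distGradient_le hcpt hne
  obtain ⟨z₀, -, φ, hφ, hlim⟩ := (isCompact_closedBall y R).tendsto_subseq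
    fun n => hR (z n) (hz n).1 ((hz n).2.trans ((hμ1 n).le.trans (hhalf n)))
  have hgrad : Tendsto (fun n => ‖distGradient M (z (φ n))‖) atTop (𝓝 0) := by
    have h1 : Tendsto (fun n : ℕ => 1 / ((n : ℝ) + 1 + 1)) atTop (𝓝 0) := by
      have := (tendsto_add_atTop_iff_nat 1).2 (tendsto_one_div_add_atTop_nhds_zero_nat (𝕜 := ℝ))
      simpa using this
    exact squeeze_zero (fun _ => norm_nonneg _)
      (fun n => (hz (φ n)).2.trans (hμ1 (φ n)).le) (h1.comp hφ.tendsto_atTop)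
  by_cases hz₀ : z₀ ∈ M
  · obtain ⟨n, h1, h2⟩ := ((hlim.eventually
      (hM.eventually_half_le_norm_distGradient hcpt hz₀)).and
      (hgrad.eventually_lt_const (by norm_num : (0 : ℝ) < 1 / 2))).exists
    exact absurd (h1 (hz (φ n)).1) (not_le.2 h2)
  · have hcrit := mem_criticalPoints_of_tendsto hcpt hne hlim (fun n => (hz (φ n)).1) hz₀ hgrad
    obtain ⟨c, hc, hev⟩ := hloc z₀ hcrit
    obtain ⟨N, hN⟩ := exists_nat_gt (1 / c)
    obtain ⟨n, h1, h2⟩ := ((hlim.eventually hev).and (eventually_ge_atTop N)).exists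
    have h3 := (h1 (hz (φ n)).1).trans (hz (φ n)).2
    refine hzfar (φ n) (mem_cthickening_of_dist_le _ z₀ _ _ hcrit ?_)
    have h4 : (N : ℝ) ≤ φ n := by exact_mod_cast h2.trans (hφ.id_le n)
    have h5 : 1 ≤ ((φ n : ℝ) + 1) * c := by
      rw [div_lt_iff₀ hc] at hN
      nlinarith
    have h6 := mul_le_mul_of_nonneg_left h3 (by positivity : (0 : ℝ) ≤ (φ n : ℝ) + 1)
    have h7 : (0 : ℝ) ≤ dist (z (φ n)) z₀ := dist_nonneg
    simp only [Function.comp_apply] at h6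
    nlinarith

theorem PropertyP1.exists_enumeratesProjections (hP1 : PropertyP1 M)
    (hz₀ : z₀ ∈ criticalPoints M) :
    ∃ (s : ℕ) (x : Fin s → EuclideanSpace ℝ (Fin D)), EnumeratesProjections M z₀ x := by
  have := (hP1.finite_projections hz₀).to_subtype
  obtain ⟨s, ⟨e⟩⟩ := Finite.exists_equiv_fin (projections M z₀)
  refine ⟨s, fun i => e.symm i, Subtype.val_injective.comp e.symm.injective, ?_⟩
  have h1 : (fun i => ((e.symm i : projections M z₀) : EuclideanSpace ℝ (Fin D))) =
      Subtype.val ∘ e.symm := rfl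
  rw [h1, e.symm.surjective.range_comp, Subtype.range_coe]

end DistanceFunction

end

theorem proposition6p1 {D m : ℕ} (M : Set (EuclideanSpace ℝ (Fin D))) (hne : M.Nonempty)
    (hcompact : IsCompact M) (hM : DistanceFunction.IsC2Submanifold m M)
    (hP1 : DistanceFunction.PropertyP1 M) (hP2 : DistanceFunction.PropertyP2 M)
    (hP3 : DistanceFunction.PropertyP3 M) :
    (DistanceFunction.PropertyP4 M ↔ DistanceFunction.BigSimplexProperty M) ∧
      (DistanceFunction.PropertyP4 M ↔ DistanceFunction.SimplexFormNondegenerate M) := by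
  refine ⟨⟨fun hP4 z₀ hz₀ => ?_, fun hbig => ?_⟩, ⟨fun hP4 z₀ hz₀ => ?_, fun hform => ?_⟩⟩
  · obtain ⟨δ', hδ', δ, hδ, hwd⟩ := hM.exists_localProjectionsWellDefined hcompact hP1 hP3 hz₀
    obtain ⟨s, x, hx⟩ := hP1.exists_enumeratesProjections hz₀
    obtain ⟨lam, hbar⟩ := hP1.exists_isInteriorBarycenter hz₀ hx
    obtain ⟨r, hr, L, hL, hvol⟩ := (hwd.exists_le_volume_iff hδ' hx hbar).2
      (hwd.isTransversallyNondegenerate_of_propertyP4 hδ' hcompact hne hz₀ hP2 hP4 hx hbar)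
    exact ⟨s, x, hx, min δ' r, lt_min hδ' hr, δ, hδ, L, hL, hwd.mono (min_le_left _ _),
      fun h hh hlt => hvol h hh (hlt.trans_le (min_le_right _ _))⟩
  · refine hM.propertyP4_of_local hcompact hne fun z₀ hz₀ => ?_
    -- The radii are those of the hypothesis. As (P4) does not mention local projections, those of
    -- different radii need never be compared.
    obtain ⟨s, x, hx, δ', hδ', δ, hδ, L, hL, hwd, hvol⟩ := hbig z₀ hz₀
    obtain ⟨lam, hbar⟩ := hP1.exists_isInteriorBarycenter hz₀ hx
    exact hwd.exists_mul_dist_le_norm_distGradient hδ' hcompact hne hx hbar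
      ((hwd.exists_le_volume_iff hδ' hx hbar).1 ⟨δ', hδ', L, hL, hvol⟩)
  · obtain ⟨δ', hδ', δ, hδ, hwd⟩ := hM.exists_localProjectionsWellDefined hcompact hP1 hP3 hz₀
    obtain ⟨s, x, hx⟩ := hP1.exists_enumeratesProjections hz₀
    obtain ⟨lam, hbar⟩ := hP1.exists_isInteriorBarycenter hz₀ hx
    exact ⟨s, x, hx, δ', hδ', δ, hδ, hwd, (hbar.simplexForm_nondegenerate_iff hx).2
      (hwd.isTransversallyNondegenerate_of_propertyP4 hδ' hcompact hne hz₀ hP2 hP4 hx hbar)⟩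
  · refine hM.propertyP4_of_local hcompact hne fun z₀ hz₀ => ?_
    obtain ⟨s, x, hx, δ', hδ', δ, hδ, hwd, hnd⟩ := hform z₀ hz₀
    obtain ⟨lam, hbar⟩ := hP1.exists_isInteriorBarycenter hz₀ hx
    exact hwd.exists_mul_dist_le_norm_distGradient hδ' hcompact hne hx hbar
      ((hbar.simplexForm_nondegenerate_iff hx).1 hnd)
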